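/- **Setting.** Let $\Sigma$ be a finite nonempty alphabet, $\overline\Sigma=\Sigma\cup\{\mathrm{EOS}\}$, and for $w=w_1\cdots w_N\in\Sigma^*$ let $\overline w=w_1\cdots w_N\,\mathrm{EOS}$. *Fixed precision.* Let $\mathbb F\subset\mathbb R\cup\{\pm\infty\}$ be any finite set containing $0,1,\pm\infty$ and closed under negation, with a rounding map: reals $\ge\Omega$ (resp. $\le-\Omega$) round to $\infty$ (resp. $-\infty$), where the overflow threshold $\Omega$ exceeds every finite element of $\mathbb F$; all other reals round to a nearest finite element (ties broken arbitrarily). All arithmetic is extended-real arithmetic followed by rounding, with $0\cdot(\pm\infty)=0$, $\infty+(-\infty)=-\infty$, $a/(\pm\infty)=0$, $a/0=0$, $\exp(\infty)=\infty$, $\exp(-\infty)=0$. The terms of a sum are rounded, and the sum is rounded once. *Transformers.* A transformer over $\mathbb F$ has a width $D$, an embedding $\overline\Sigma\to\mathbb F^D$ (no positional encoding), a finite sequence of hidden layers with parameters in $\mathbb F$, and a classification head. Each hidden layer maps $X$ first to $Y=\mathrm{LN}(\mathrm{Att}(X)+X)$ and then to $\mathrm{LN}(\mathrm{FF}(Y)+Y)$,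 where $\mathrm{FF}(v)=W_2\,\mathrm{ReLU}(W_1v+b_1)+b_2$; $\mathrm{LN}$ is layer normalization $g\cdot(v-\mu)/\sigma+b$ (mean $\mu$ and standard deviation $\sigma$ over the coordinates, learnable gain $g$ and bias $b$ for each occurrence, correctly rounded); and $\mathrm{Att}(X)_n=\sum_{m<n}\alpha_{n,m}W_VX_m$ is one attention head with strict future masking and scores $S_{n,m}=(W_QX_n)\cdot(W_KX_m)/\sqrt D$. The weights are, for $m<n$, - soft attention (SA): $\alpha_{n,m}=\exp(S_{n,m})/\sum_{i<n}\exp(S_{n,i})$; - average hard attention (AHA): $\alpha_{n,m}=\mathbf 1[S_{n,m}=\max_{i<n}S_{n,i}]\big/\sum_{j<n}\mathbf 1[S_{n,j}=\max_{i<n}S_{n,i}]$; - unique hard attention (UHA): $\alpha_{n,m}=1$ for the rightmost $m<n$ maximizing $S_{n,m}$, and $0$ otherwise. The output on $w$ is $\theta^\top x+b$, where $x$ is the final-layer vector at the EOS position of $\overline w$; $w$ is accepted iff the output is $>0$. Write $\mathrm{SA}$, $\mathrm{AHA}$, $\mathrm{UHA}$ for the classes of languages over $\Sigma$ recognized by transformers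 over $\mathbb F$ with the respective attention. *Logics.* $\mathrm{PTL}$ formulas over an alphabet are built from letter predicates $\pi_a$ by $\land,\lnot$ and the strict past operator $\mathbf P$ ($w,n\models\mathbf P\psi$ iff $w,m\models\psi$ for some $m<n$); a string of length $N$ satisfies $\psi$ iff it does so at position $N+1$, where no letter stands. $\mathrm{PFO}^2$ formulas use two variables $x,y$, atoms $\pi_a(\cdot)$ and $\cdot<\cdot$, Boolean connectives, bounded quantifiers $\exists y<x$, $\exists x<y$ (applied to formulas in which the bound variable occurs free), and unbounded quantifiers $\exists x$, $\exists y$ (applied to formulas whose only free variable is the bound one); sentences define languages. **Theorem.** For every such $\Sigma$ and $\mathbb F$: 1. Every transformer with AHA is simulated by $\mathrm{PFO}^2$: for each coordinate $d$ of the final layer and each $f\in\mathbb F$ there is a $\mathrm{PFO}^2$ formula $\varphi(x)$ over $\overline\Sigma$ with one free variable and without unbounded quantifiers such that for all $w\in\Sigma^*$ and all positions $n$ of $\overline w$, coordinate $d$ at position $n$ equals $f$ iff $\overline w,n\models\varphi$. Likewise, for each $f$, such a formula, evaluated at the EOS position, defines the strings on which the scalar output equals $f$. 2. Every $\mathrm{PTL}$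 formula $\psi$ over $\overline\Sigma$ is simulated by a transformer with AHA: some coordinate of its final layer equals, for all $w\in\Sigma^*$ and all positions $n$ of $\overline w$, $1$ if $\overline w,n\models\psi$ and $0$ otherwise. 3. $\mathrm{AHA}=\mathrm{SA}$, and both equal the class of languages definable in $\mathrm{PTL}$, which is also the class of languages definable in $\mathrm{PFO}^2$. 4. $\mathrm{AHA}\subseteq\mathrm{UHA}$ and $\mathrm{SA}\subseteq\mathrm{UHA}$, and both inclusions are strict whenever $\Sigma$ has at least two letters. -/

import Mathlib

noncomputable section

/-! ### Past temporal logic -/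

/-- Formulas of the past fragment `PTL` of linear temporal logic over the alphabet `α`. -/
inductive PTL (α : Type*) where
  | atom : α → PTL α
  | and : PTL α → PTL α → PTL α
  | not : PTL α → PTL α
  | past : PTL α → PTL α

namespace PTL

variable {α : Type*}

/-- `ψ.Sat w n`: the string `w` satisfies `ψ` at position `n`. Positions are counted from `0`;
position `w.length` is the one just beyond the end, where no letter stands. -/
def Sat (w : List α) : PTL α → ℕ → Prop
  | atom a, n => w[n]? = some a
  | and φ ψ, n => Sat w φ n ∧ Sat w ψ n
  | not φ, n => ¬ Sat w φ n
  | past φ, n => ∃ m, m < n ∧ Sat w φ m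

/-- The language of a formula: evaluation takes place just beyond the end of the string. -/
def language (ψ : PTL α) : Language α := {w | ψ.Sat w w.length}

/-- The class of languages defined by `PTL` formulas. -/
def definable (α : Type*) : Set (Language α) := {L | ∃ ψ : PTL α, ψ.language = L}

end PTL

/-! ### The past fragment of two-variable first-order logic -/

/-- The two variables. -/
inductive TwoVar where
  | x : TwoVar
  | y : TwoVar
  deriving DecidableEq

/-- The other variable. -/
def TwoVar.other : TwoVar → TwoVar
  | x => y
  | y => x

/-- Raw formulas of `PFO²`. `exLt v φ` is the bounded quantification `∃ v < u : φ`, where `u` is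
the variable other than `v`, and `ex v φ` is the unbounded quantification `∃ v : φ`. -/
inductive PFO (α : Type*) where
  | atom : α → TwoVar → PFO α
  | lt : TwoVar → TwoVar → PFO α
  | and : PFO α → PFO α → PFO α
  | not : PFO α → PFO α
  | exLt : TwoVar → PFO α → PFO α
  | ex : TwoVar → PFO α → PFO α

namespace PFO

variable {α : Type*}

/-- Free variables. -/
def free : PFO α → Set TwoVar
  | atom _ v => {v}
  | lt u v => {u, v}
  | and φ ψ => φ.free ∪ ψ.free
  | not φ => φ.free
  | exLt v φ => (φ.free \ {v}) ∪ {v.other}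
  | ex v φ => φ.free \ {v}

/-- The formation rules: `∃ v < u` may be applied to a formula in which `v` occurs free, and
`∃ v` to a formula whose only free variable is `v`. -/
def IsFormula : PFO α → Prop
  | atom _ _ => True
  | lt _ _ => True
  | and φ ψ => φ.IsFormula ∧ ψ.IsFormula
  | not φ => φ.IsFormula
  | exLt v φ => φ.IsFormula ∧ v ∈ φ.free
  | ex v φ => φ.IsFormula ∧ φ.free = {v}

/-- All quantifiers are bounded, so that the formula cannot look into the future. -/
def IsBounded : PFO α → Prop
  | atom _ _ => True
  | lt _ _ => True
  | and φ ψ => φ.IsBounded ∧ ψ.IsBounded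
  | not φ => φ.IsBounded
  | exLt _ φ => φ.IsBounded
  | ex _ _ => False

/-- Satisfaction in the string `w` under an assignment of positions (counted from `0`). -/
def Sat (w : List α) : PFO α → (TwoVar → ℕ) → Prop
  | atom a v, ρ => w[ρ v]? = some a
  | lt u v, ρ => ρ u < ρ v
  | and φ ψ, ρ => Sat w φ ρ ∧ Sat w ψ ρ
  | not φ, ρ => ¬ Sat w φ ρ
  | exLt v φ, ρ => ∃ m, m < ρ v.other ∧ Sat w φ (Function.update ρ v m)
  | ex v φ, ρ => ∃ m, m < w.length ∧ Sat w φ (Function.update ρ v m)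

/-- The language of a sentence (a formula without free variables: the assignment is irrelevant). -/
def language (φ : PFO α) : Language α := {w | φ.Sat w (fun _ => 0)}

/-- The class of languages defined by sentences of `PFO²`. -/
def definable (α : Type*) : Set (Language α) :=
  {L | ∃ φ : PFO α, φ.IsFormula ∧ φ.free = ∅ ∧ φ.language = L}

end PFO

/-! ### Fixed-precision arithmetic -/

/-- A fixed-precision number format: a finite set `vals` of finite values that contains `0` and `1`
and is closed under negation, an overflow threshold `bound` above all of them, and a
round-to-nearest map `nearest` (which is determined up to the breaking of ties).
The number format itself consists of `vals` and the two infinities. -/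
structure FloatFormat where
  vals : Finset ℝ
  zero_mem : (0 : ℝ) ∈ vals
  one_mem : (1 : ℝ) ∈ vals
  neg_mem : ∀ x ∈ vals, -x ∈ vals
  bound : ℝ
  lt_bound : ∀ x ∈ vals, x < bound
  nearest : ℝ → ℝ
  nearest_mem : ∀ x, nearest x ∈ vals
  nearest_le : ∀ x, ∀ y ∈ vals, |x - nearest x| ≤ |x - y|

namespace FloatFormat

/-- The finite set `𝔽` of floating-point numbers: the finite values and `±∞`. -/
abbrev Val (F : FloatFormat) : Type :=
  {x : EReal // x = ⊤ ∨ x = ⊥ ∨ ∃ r ∈ F.vals, x = (r : EReal)}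

open Classical in
/-- Rounding: overflow to `±∞` at `±bound`, and to a nearest finite value in between. -/
def round (F : FloatFormat) (z : EReal) : F.Val :=
  if (F.bound : EReal) ≤ z then ⟨⊤, Or.inl rfl⟩
  else if z ≤ ((-F.bound : ℝ) : EReal) then ⟨⊥, Or.inr (Or.inl rfl)⟩
  else ⟨(F.nearest z.toReal : EReal), Or.inr (Or.inr ⟨_, F.nearest_mem _, rfl⟩)⟩

variable (F : FloatFormat)

/- All operations below are those of `EReal` followed by rounding. In `EReal` one has `0 * ±∞ = 0`,
`∞ + (-∞) = -∞`, `a / ±∞ = 0` and `a / 0 = 0`. A sum is rounded once. -/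

/-- Dot product, with rounded products. -/
def dot {k : ℕ} (u v : Fin k → F.Val) : F.Val :=
  F.round (∑ i, (F.round ((u i : EReal) * (v i : EReal)) : EReal))

/-- Matrix-vector product. -/
def mulVec {k l : ℕ} (W : Matrix (Fin l) (Fin k) F.Val) (v : Fin k → F.Val) : Fin l → F.Val :=
  fun i => F.dot (W i) v

/-- Entrywise sum. -/
def vadd {k : ℕ} (u v : Fin k → F.Val) : Fin k → F.Val :=
  fun i => F.round ((u i : EReal) + (v i : EReal))

/-- The rectified linear unit, entrywise. -/
def relu {k : ℕ} (u : Fin k → F.Val) : Fin k → F.Val :=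
  fun i => F.round (max (u i : EReal) 0)

/-- The exponential function, with `exp ∞ = ∞` and `exp (-∞) = 0`. -/
def expo (a : F.Val) : F.Val := F.round ((EReal.exp (a : EReal) : ENNReal) : EReal)

/-- The square root of a nonnegative extended real. -/
def _root_.EReal.sqrtNonneg (z : EReal) : EReal := ((z.toENNReal ^ (1 / 2 : ℝ) : ENNReal) : EReal)

/-- Layer normalization with gain `g` and bias `b`:
`g * (v - mean) / (standard deviation) + b`, correctly rounded. -/
def layerNorm {k : ℕ} (g b : Fin k → F.Val) (v : Fin k → F.Val) : Fin k → F.Val :=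
  let μ : EReal := (∑ i, (v i : EReal)) / (k : EReal)
  let σ : EReal :=
    EReal.sqrtNonneg ((∑ i, ((v i : EReal) - μ) * ((v i : EReal) - μ)) / (k : EReal))
  fun i => F.round ((g i : EReal) * (((v i : EReal) - μ) / σ) + (b i : EReal))

end FloatFormat

/-! ### Transformers with strict future masking and no positional encoding -/

/-- The three attention mechanisms: soft, average hard, and unique hard (rightmost) attention. -/
inductive AttentionKind where
  | soft : AttentionKind
  | averageHard : AttentionKind
  | uniqueHard : AttentionKind

section Attention

variable (F : FloatFormat) {N : ℕ}

/-- Position `m < n` has the maximum score among the positions before `n`. -/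
def IsMaxScore (S : Fin N → Fin N → F.Val) (n m : Fin N) : Prop :=
  ∀ i, i < n → (S n i : EReal) ≤ (S n m : EReal)

open Classical in
/-- The attention weight of position `m < n` at position `n`, for the scores `S`. -/
def attentionWeight (S : Fin N → Fin N → F.Val) (n m : Fin N) : AttentionKind → F.Val
  | .soft =>
      F.round ((F.expo (S n m) : EReal) /
        (F.round (∑ i ∈ Finset.Iio n, (F.expo (S n i) : EReal)) : EReal))
  | .averageHard =>
      F.round ((if IsMaxScore F S n m then (1 : EReal) else 0) /
        (F.round (∑ j ∈ Finset.Iio n, if IsMaxScore F S n j then (1 : EReal) else 0) : EReal))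
  | .uniqueHard =>
      F.round (if IsMaxScore F S n m ∧ ∀ i, i < n → IsMaxScore F S n i → i ≤ m
        then (1 : EReal) else 0)

end Attention

/-- The parameters of one hidden layer of width `D`: the projections of the (single) attention
head, the feedforward network, and the two layer normalizations. -/
structure TransformerLayer (F : FloatFormat) (D : ℕ) where
  WQ : Matrix (Fin D) (Fin D) F.Val
  WK : Matrix (Fin D) (Fin D) F.Val
  WV : Matrix (Fin D) (Fin D) F.Val
  gain₁ : Fin D → F.Val
  bias₁ : Fin D → F.Val
  hiddenSize : ℕ
  W₁ : Matrix (Fin hiddenSize) (Fin D) F.Val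
  b₁ : Fin hiddenSize → F.Val
  W₂ : Matrix (Fin D) (Fin hiddenSize) F.Val
  b₂ : Fin D → F.Val
  gain₂ : Fin D → F.Val
  bias₂ : Fin D → F.Val

namespace TransformerLayer

variable {F : FloatFormat} {D N : ℕ} (ℓ : TransformerLayer F D)

/-- Scaled dot-product scores. -/
def score (X : Fin N → Fin D → F.Val) (n m : Fin N) : F.Val :=
  F.round ((F.dot (F.mulVec ℓ.WQ (X n)) (F.mulVec ℓ.WK (X m)) : EReal) /
    ((Real.sqrt (D : ℝ) : ℝ) : EReal))

/-- The strictly masked self-attention sublayer. -/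
def attention (A : AttentionKind) (X : Fin N → Fin D → F.Val) : Fin N → Fin D → F.Val :=
  fun n d => F.round (∑ m ∈ Finset.Iio n,
    (F.round ((attentionWeight F (ℓ.score X) n m A : EReal) *
      (F.mulVec ℓ.WV (X m) d : EReal)) : EReal))

/-- The feedforward sublayer, at one position. -/
def feedforward (v : Fin D → F.Val) : Fin D → F.Val :=
  F.vadd (F.mulVec ℓ.W₂ (F.relu (F.vadd (F.mulVec ℓ.W₁ v) ℓ.b₁))) ℓ.b₂

/-- One hidden layer: both sublayers with residual connection and layer normalization. -/
def apply (A : AttentionKind) (X : Fin N → Fin D → F.Val) : Fin N → Fin D → F.Val :=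
  let Y : Fin N → Fin D → F.Val := fun n =>
    F.layerNorm ℓ.gain₁ ℓ.bias₁ (F.vadd (ℓ.attention A X n) (X n))
  fun n => F.layerNorm ℓ.gain₂ ℓ.bias₂ (F.vadd (ℓ.feedforward (Y n)) (Y n))

end TransformerLayer

/-- The string followed by the end-of-sentence symbol, which is `none`. -/
def withEOS {α : Type*} (w : List α) : List (Option α) := w.map some ++ [none]

theorem length_withEOS {α : Type*} (w : List α) : (withEOS w).length = w.length + 1 := by
  simp [withEOS]

/-- The position of the end-of-sentence symbol. -/
def eosPos {α : Type*} (w : List α) : Fin (withEOS w).length :=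
  ⟨w.length, by rw [length_withEOS]; exact Nat.lt_succ_self _⟩

/-- A transformer over the alphabet `α`: width, embedding, hidden layers, classification head. -/
structure Transformer (F : FloatFormat) (α : Type*) where
  dim : ℕ
  embed : Option α → Fin dim → F.Val
  layers : List (TransformerLayer F dim)
  headWeight : Fin dim → F.Val
  headBias : F.Val

namespace Transformer

variable {F : FloatFormat} {α : Type*} (T : Transformer F α)

/-- The representations in the final layer, at each position of the extended string. -/
def final (A : AttentionKind) (w : List α) : Fin (withEOS w).length → Fin T.dim → F.Val :=
  T.layers.foldl (fun X ℓ => ℓ.apply A X) (fun n => T.embed ((withEOS w).get n))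

/-- The scalar output. -/
def output (A : AttentionKind) (w : List α) : F.Val :=
  F.round ((F.dot T.headWeight (T.final A w (eosPos w)) : EReal) + (T.headBias : EReal))

/-- The language of accepted strings. -/
def language (A : AttentionKind) : Language α := {w | (0 : EReal) < (T.output A w : EReal)}

/-- The class of languages recognized by transformers over the number format `F` with attention
mechanism `A`. -/
def recognizable (F : FloatFormat) (A : AttentionKind) (α : Type*) : Set (Language α) :=
  {L | ∃ T : Transformer F α, T.language A = L}

/-- The transformer is simulated by `PFO²`: for each coordinate of the final layer and each value,
a one-variable formula (without unbounded quantifiers) over the extended alphabet defines the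
positions where the coordinate takes that value; likewise for the scalar output, at the
end-of-sentence position. -/
def SimulatedByPFO (A : AttentionKind) : Prop :=
  (∀ (d : Fin T.dim) (f : F.Val), ∃ φ : PFO (Option α),
    φ.IsFormula ∧ φ.IsBounded ∧ φ.free = {TwoVar.x} ∧
    ∀ (w : List α) (n : Fin (withEOS w).length),
      T.final A w n d = f ↔ φ.Sat (withEOS w) (fun _ => n)) ∧
  (∀ f : F.Val, ∃ φ : PFO (Option α),
    φ.IsFormula ∧ φ.IsBounded ∧ φ.free = {TwoVar.x} ∧
    ∀ w : List α, T.output A w = f ↔ φ.Sat (withEOS w) (fun _ => (eosPos w : ℕ)))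

/-- The `PTL` formula `ψ` over the extended alphabet is simulated by the transformer: some
coordinate of the final layer is its truth value at each position. -/
def SimulatesPTL (A : AttentionKind) (ψ : PTL (Option α)) : Prop :=
  ∃ d : Fin T.dim, ∀ (w : List α) (n : Fin (withEOS w).length),
    (ψ.Sat (withEOS w) n → (T.final A w n d : EReal) = 1) ∧
    (¬ ψ.Sat (withEOS w) n → (T.final A w n d : EReal) = 0)

end Transformer

end

noncomputable section

/-! ### Closure properties of definability in `PTL` -/

namespace PTL

variable {α Q R : Type*}

/-! At fixed precision, soft and average hard attention can count only up to a threshold, and the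
strict past operator can count that far; conversely, three-valued scores `∞, 0, -∞` suffice to
express the past operator.

Upper bound. The positive numbers of the format are at least some `ε > 0`. If a vector of nonzero
unnormalized weight occurs `T` times, with `T * ε` beyond the overflow threshold, the normalizer
rounds to `∞`, every quotient is `0`, and so is the attention. Otherwise each vector of nonzero
weight occurs fewer than `T` times. Either way the result depends only on the query and on
multiplicities truncated at `T` (`weighted_sum_congr`, `exists_attentionSeq_congr`). Truncated
multiplicities are `PTL`-definable by nesting past operators (`Definable.lt_countBefore`), so
definability passes through the layers (`DefinableFun.applySeq`).

Lower bound. Padding a vector with many pairs `1, -1` brings its mean near `0` and its deviation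
near `1`, so that rounding makes layer normalization the identity (`exists_goodPadding`).
Coordinates then serve as registers. A feedforward layer with weights `-∞` computes NOR, hence all
Boolean connectives. For the past operator, attending directly to the positions where `P` holds
could fail, since the shared weight may round to `0`. Instead positions with `P` get score `∞`, the
first position gets `0` unless it has `P`, and the rest get `-∞`; the first position receives weight
`1` exactly when `P` has not occurred (`attainable_past`). The first position itself is found by two
nearly uniform attentions (`attainable_first`). The construction works for all three kinds of
attention.

`PFO²` reduces to `PTL` because a formula sees only finite definable types of its variables and
their order (`PFO.exists_type`). Rightmost unique hard attention can also look at the previous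
position and so test the last letter; no `PTL` formula can, since its value on prefixes of `abab…`
is eventually constant. -/

theorem sat_congr (ψ : PTL α) {w w' : List α} {n : ℕ} (h : ∀ i ≤ n, w[i]? = w'[i]?) :
    ψ.Sat w n ↔ ψ.Sat w' n := by
  induction ψ generalizing n with
  | atom a => simp [Sat, h n le_rfl]
  | and φ ψ ih₁ ih₂ => simp [Sat, ih₁ h, ih₂ h]
  | not φ ih => simp [Sat, ih h]
  | past φ ih =>
    simp only [Sat]
    exact exists_congr fun m => and_congr_right fun hm => ih fun i hi => h i (hi.trans hm.le)

/-- A property of pointed strings that is expressed by a formula. -/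
def Definable (p : List α → ℕ → Prop) : Prop := ∃ ψ : PTL α, ∀ w n, ψ.Sat w n ↔ p w n

/-- A function on pointed strings whose fibres are definable. -/
def DefinableFun (f : List α → ℕ → Q) : Prop := ∀ q, Definable fun w n => f w n = q

theorem definable_atom (a : α) : Definable fun w n => w[n]? = some a := ⟨atom a, fun _ _ => Iff.rfl⟩

theorem Definable.congr {p q : List α → ℕ → Prop} (hp : Definable p) (h : ∀ w n, p w n ↔ q w n) :
    Definable q := by
  obtain ⟨ψ, hψ⟩ := hp
  exact ⟨ψ, fun w n => (hψ w n).trans (h w n)⟩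

theorem Definable.not {p : List α → ℕ → Prop} (hp : Definable p) :
    Definable fun w n => ¬ p w n := by
  obtain ⟨ψ, hψ⟩ := hp
  exact ⟨ψ.not, fun w n => by simp [Sat, hψ]⟩

theorem Definable.and {p q : List α → ℕ → Prop} (hp : Definable p) (hq : Definable q) :
    Definable fun w n => p w n ∧ q w n := by
  obtain ⟨φ, hφ⟩ := hp
  obtain ⟨ψ, hψ⟩ := hq
  exact ⟨φ.and ψ, fun w n => by simp [Sat, hφ, hψ]⟩

theorem Definable.or {p q : List α → ℕ → Prop} (hp : Definable p) (hq : Definable q) :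
    Definable fun w n => p w n ∨ q w n :=
  (hp.not.and hq.not).not.congr fun w n => by tauto

theorem Definable.past {p : List α → ℕ → Prop} (hp : Definable p) :
    Definable fun w n => ∃ m < n, p w m := by
  obtain ⟨ψ, hψ⟩ := hp
  exact ⟨ψ.past, fun w n => by simp [Sat, hψ]⟩

/-- The syntax has no constants, so falsity must be built from some letter; this is where
nonemptiness of the alphabet enters. -/
theorem definable_false [Nonempty α] : Definable fun (_ : List α) _ => False := by
  obtain ⟨a⟩ := ‹Nonempty α›
  exact ((definable_atom a).and (definable_atom a).not).congr fun w n => by simp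

theorem definable_const [Nonempty α] (p : Prop) : Definable fun (_ : List α) _ => p := by
  by_cases hp : p
  · exact definable_false.not.congr fun w n => by simp [hp]
  · exact definable_false.congr fun w n => by simp [hp]

theorem Definable.exists_mem [Nonempty α] {ι : Type*} (s : Finset ι)
    {p : ι → List α → ℕ → Prop} (hp : ∀ i ∈ s, Definable (p i)) :
    Definable fun w n => ∃ i ∈ s, p i w n := by
  classical
  induction s using Finset.induction_on with
  | empty => simpa using definable_false
  | insert i s _ ih =>
    refine ((hp i (by simp)).or (ih fun j hj => hp j (by simp [hj]))).congr fun w n => ?_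
    simp

theorem Definable.exists [Nonempty α] {ι : Type*} [Finite ι]
    {p : ι → List α → ℕ → Prop} (hp : ∀ i, Definable (p i)) :
    Definable fun w n => ∃ i, p i w n := by
  cases nonempty_fintype ι
  exact (Definable.exists_mem Finset.univ fun i _ => hp i).congr fun w n => by simp

theorem Definable.forall [Nonempty α] {ι : Type*} [Finite ι]
    {p : ι → List α → ℕ → Prop} (hp : ∀ i, Definable (p i)) :
    Definable fun w n => ∀ i, p i w n :=
  (Definable.exists fun i => (hp i).not).not.congr fun w n => by simp

theorem DefinableFun.pred [Nonempty α] [Finite Q] {f : List α → ℕ → Q} (hf : DefinableFun f)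
    (P : Q → Prop) : Definable fun w n => P (f w n) :=
  (Definable.exists fun q : {q // P q} => hf q).congr fun w n => by simp

theorem DefinableFun.comp [Nonempty α] [Finite Q] {f : List α → ℕ → Q} (hf : DefinableFun f)
    (g : Q → R) : DefinableFun fun w n => g (f w n) := fun r => hf.pred fun q => g q = r

/-- This allows definability to be concluded from a congruence alone, without writing down the
induced map on the finite set of values. -/
theorem DefinableFun.of_factors [Nonempty α] [Finite Q] {f : List α → ℕ → Q}
    (hf : DefinableFun f) {g : List α → ℕ → R}
    (h : ∀ w n w' n', f w n = f w' n' → g w n = g w' n') : DefinableFun g := fun r =>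
  (hf.pred fun q => ∃ w n, f w n = q ∧ g w n = r).congr fun w n =>
    ⟨fun ⟨_, _, h₁, h₂⟩ => h₂ ▸ (h _ _ _ _ h₁).symm, fun hr => ⟨w, n, rfl, hr⟩⟩

theorem DefinableFun.prodMk {f : List α → ℕ → Q} {g : List α → ℕ → R}
    (hf : DefinableFun f) (hg : DefinableFun g) : DefinableFun fun w n => (f w n, g w n) :=
  fun q => ((hf q.1).and (hg q.2)).congr fun w n => by simp [Prod.ext_iff]

theorem DefinableFun.pi [Nonempty α] {ι : Type*} [Finite ι] {f : ι → List α → ℕ → Q}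
    (hf : ∀ i, DefinableFun (f i)) : DefinableFun fun w n i => f i w n :=
  fun q => (Definable.forall fun i => hf i (q i)).congr fun w n => by simp [funext_iff]

theorem Definable.definableFun {p : List α → ℕ → Prop} (hp : Definable p) : DefinableFun p := by
  intro q
  by_cases hq : q
  · exact hp.congr fun w n => by simp [hq]
  · exact hp.not.congr fun w n => by simp [hq]

theorem definableFun_const [Nonempty α] (q : Q) : DefinableFun fun (_ : List α) _ => q :=
  fun r => definable_const (q = r)

theorem definableFun_letter [Nonempty α] [Finite α] :
    DefinableFun fun (w : List α) n => w[n]? := by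
  rintro (_ | a)
  · refine (Definable.forall fun a => (definable_atom a).not).congr fun w n => ?_
    exact Option.eq_none_iff_forall_ne_some.symm
  · exact definable_atom a

/-- The set of values seen so far is exactly the information that a bounded quantifier can extract.
-/
theorem DefinableFun.pastValues [Nonempty α] [Finite Q] {f : List α → ℕ → Q}
    (hf : DefinableFun f) : DefinableFun fun w n q => ∃ m < n, f w m = q :=
  .pi fun q => (hf q).past.definableFun

/-! ### Counting up to a threshold -/

/-- Number of positions before `n` at which `p` holds. -/
def countBefore (p : ℕ → Prop) (n : ℕ) : ℕ :=
  open Classical in ((Finset.range n).filter p).card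

/-- The last occurrence of `p` before `n` has all the other occurrences before it. This turns each
increase of the threshold into one more past operator. -/
theorem lt_countBefore_succ (p : ℕ → Prop) (k n : ℕ) :
    k + 1 < countBefore p n ↔ ∃ m < n, p m ∧ k < countBefore p m := by
  classical
  induction n with
  | zero => simp [countBefore]
  | succ n ih =>
    by_cases hp : p n
    · have h1 : countBefore p (n + 1) = countBefore p n + 1 := by
        simp [countBefore, Finset.range_add_one, Finset.filter_insert, hp]
      rw [h1]
      constructor
      · intro h
        exact ⟨n, by omega, hp, by omega⟩
      · rintro ⟨m, hm, hpm, hk⟩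
        have : countBefore p m ≤ countBefore p n :=
          Finset.card_le_card (Finset.filter_subset_filter _ (by simpa using Nat.le_of_lt_succ hm))
        omega
    · have h1 : countBefore p (n + 1) = countBefore p n := by
        simp [countBefore, Finset.range_add_one, Finset.filter_insert, hp]
      rw [h1, ih]
      refine exists_congr fun m => ?_
      constructor
      · rintro ⟨h₁, h₂⟩
        exact ⟨by omega, h₂⟩
      · rintro ⟨h₁, h₂, h₃⟩
        have : m ≠ n := by rintro rfl; exact hp h₂
        exact ⟨by omega, h₂, h₃⟩

theorem Definable.lt_countBefore {p : List α → ℕ → Prop} (hp : Definable p) (k : ℕ) :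
    Definable fun w n => k < countBefore (p w) n := by
  induction k with
  | zero =>
    refine hp.past.congr fun w n => ?_
    simp [countBefore, Finset.card_pos, Finset.Nonempty]
  | succ k ih =>
    exact (hp.and ih).past.congr fun w n => by rw [lt_countBefore_succ]

end PTL

/-! ### `PFO²` and `PTL` define the same languages -/

namespace PTL

variable {α : Type*}

/-- The formula of `PFO²` with one free variable `v` that expresses a formula of `PTL`. -/
def toPFO : TwoVar → PTL α → PFO α
  | v, atom a => .atom a v
  | v, and φ ψ => .and (φ.toPFO v) (ψ.toPFO v)
  | v, not φ => .not (φ.toPFO v)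
  | v, past φ => .exLt v.other (φ.toPFO v.other)

theorem other_other (v : TwoVar) : v.other.other = v := by cases v <;> rfl

theorem free_toPFO (ψ : PTL α) (v : TwoVar) : (ψ.toPFO v).free = {v} := by
  induction ψ generalizing v with
  | atom a => rfl
  | and φ ψ h₁ h₂ => simp [toPFO, PFO.free, h₁, h₂]
  | not φ h => simp [toPFO, PFO.free, h]
  | past φ h => simp [toPFO, PFO.free, h, other_other]

theorem isFormula_toPFO (ψ : PTL α) (v : TwoVar) : (ψ.toPFO v).IsFormula := by
  induction ψ generalizing v with
  | atom a => trivial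
  | and φ ψ h₁ h₂ => exact ⟨h₁ v, h₂ v⟩
  | not φ h => exact h v
  | past φ h => exact ⟨h _, by rw [free_toPFO]; rfl⟩

theorem isBounded_toPFO (ψ : PTL α) (v : TwoVar) : (ψ.toPFO v).IsBounded := by
  induction ψ generalizing v with
  | atom a => trivial
  | and φ ψ h₁ h₂ => exact ⟨h₁ v, h₂ v⟩
  | not φ h => exact h v
  | past φ h => exact h _

theorem sat_toPFO (ψ : PTL α) (v : TwoVar) (w : List α) (ρ : TwoVar → ℕ) :
    (ψ.toPFO v).Sat w ρ ↔ ψ.Sat w (ρ v) := by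
  induction ψ generalizing v ρ with
  | atom a => rfl
  | and φ ψ h₁ h₂ => simp [toPFO, PFO.Sat, Sat, h₁, h₂]
  | not φ h => simp [toPFO, PFO.Sat, Sat, h]
  | past φ h => simp [toPFO, PFO.Sat, Sat, h, other_other]

/-- The sentence of `PFO²` that expresses a formula of `PTL` just beyond the end of the string. -/
def toSentence : PTL α → PFO α
  | atom _ => .ex .x (.lt .x .x)
  | and φ ψ => .and φ.toSentence ψ.toSentence
  | not φ => .not φ.toSentence
  | past φ => .ex .x (φ.toPFO .x)

theorem free_toSentence (ψ : PTL α) : ψ.toSentence.free = ∅ := by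
  induction ψ with
  | atom a => simp [toSentence, PFO.free]
  | and φ ψ h₁ h₂ => simp [toSentence, PFO.free, h₁, h₂]
  | not φ h => simpa [toSentence, PFO.free] using h
  | past φ h => simp [toSentence, PFO.free, free_toPFO]

theorem isFormula_toSentence (ψ : PTL α) : ψ.toSentence.IsFormula := by
  induction ψ with
  | atom a => simp [toSentence, PFO.IsFormula, PFO.free]
  | and φ ψ h₁ h₂ => exact ⟨h₁, h₂⟩
  | not φ h => exact h
  | past φ h => exact ⟨isFormula_toPFO _ _, free_toPFO _ _⟩

theorem sat_toSentence (ψ : PTL α) (w : List α) (ρ : TwoVar → ℕ) :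
    ψ.toSentence.Sat w ρ ↔ ψ.Sat w w.length := by
  induction ψ with
  | atom a => simp [toSentence, PFO.Sat, Sat]
  | and φ ψ h₁ h₂ => simp [toSentence, PFO.Sat, Sat, h₁, h₂]
  | not φ h => simp [toSentence, PFO.Sat, Sat, h]
  | past φ h => simp [toSentence, PFO.Sat, Sat, sat_toPFO]

end PTL

namespace PFO

variable {α : Type*}

theorem sat_congr (φ : PFO α) (w : List α) {ρ ρ' : TwoVar → ℕ} (h : ∀ v ∈ φ.free, ρ v = ρ' v) :
    φ.Sat w ρ ↔ φ.Sat w ρ' := by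
  induction φ generalizing ρ ρ' with
  | atom a v => simp [Sat, h v (by simp [free])]
  | lt u v => simp [Sat, h u (by simp [free]), h v (by simp [free])]
  | and φ ψ h₁ h₂ =>
    simp only [Sat]
    rw [h₁ fun v hv => h v (by simp [free, hv]), h₂ fun v hv => h v (by simp [free, hv])]
  | not φ ih => simp only [Sat]; rw [ih fun v hv => h v hv]
  | exLt v φ ih =>
    simp only [Sat, h v.other (by simp [free])]
    refine exists_congr fun m => and_congr_right fun _ => ih fun u hu => ?_
    by_cases huv : u = v
    · simp [huv]
    · simp [Function.update_of_ne huv, h u (by simp [free, hu, huv])]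
  | ex v φ ih =>
    simp only [Sat]
    refine exists_congr fun m => and_congr_right fun _ => ih fun u hu => ?_
    by_cases huv : u = v
    · simp [huv]
    · simp [Function.update_of_ne huv, h u (by simp [free, hu, huv])]

/-- Up to the relative order of the two variables, the truth of a formula of `PFO²` depends on the
values of a `PTL`-definable function at the two variables and just beyond the end of the string. -/
theorem exists_type [Nonempty α] (φ : PFO α) (hφ : φ.IsFormula) :
    ∃ (Q : Type) (_ : Finite Q) (f : List α → ℕ → Q) (g : Q → (TwoVar → Q) → Ordering → Prop),
      PTL.DefinableFun f ∧ ∀ w ρ,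
        φ.Sat w ρ ↔ g (f w w.length) (fun v => f w (ρ v)) (compare (ρ .x) (ρ .y)) := by
  induction φ with
  | atom a v =>
    exact ⟨Prop, inferInstance, fun w n => w[n]? = some a, fun _ q _ => q v,
      (PTL.definable_atom a).definableFun, fun w ρ => Iff.rfl⟩
  | lt u v =>
    refine ⟨Unit, inferInstance, fun _ _ => (), fun _ _ o =>
      match u, v with
      | .x, .y => o = .lt
      | .y, .x => o = .gt
      | _, _ => False, PTL.definableFun_const _, fun w ρ => ?_⟩
    cases u <;> cases v <;> simp [Sat, compare_lt_iff_lt, compare_gt_iff_gt]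
  | and φ ψ h₁ h₂ =>
    obtain ⟨Q₁, _, f₁, g₁, hf₁, hg₁⟩ := h₁ hφ.1
    obtain ⟨Q₂, _, f₂, g₂, hf₂, hg₂⟩ := h₂ hφ.2
    refine ⟨Q₁ × Q₂, inferInstance, fun w n => (f₁ w n, f₂ w n), fun e q o =>
      g₁ e.1 (fun v => (q v).1) o ∧ g₂ e.2 (fun v => (q v).2) o, hf₁.prodMk hf₂, fun w ρ => ?_⟩
    simp only [Sat, hg₁, hg₂]
  | not φ ih =>
    obtain ⟨Q, hQ, f, g, hf, hg⟩ := ih hφ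
    exact ⟨Q, hQ, f, fun e q o => ¬ g e q o, hf, fun w ρ => by simp only [Sat, hg]⟩
  | exLt v φ ih =>
    obtain ⟨Q, hQ, f, g, hf, hg⟩ := ih hφ.1
    -- The type is enriched by the set of types seen earlier. The order after the quantifier is
    -- forced, since the new position lies before the other variable.
    refine ⟨Q × (Q → Prop), inferInstance, fun w n => (f w n, fun q => ∃ m < n, f w m = q),
      fun e q _ => ∃ r, (q v.other).2 r ∧
        g e.1 (Function.update (fun u => (q u).1) v r) (match v with | .x => .lt | .y => .gt),
      hf.prodMk hf.pastValues, fun w ρ => ?_⟩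
    simp only [Sat, hg]
    have key : ∀ m, m < ρ v.other → (g (f w w.length)
        (fun u => f w (Function.update ρ v m u))
        (compare (Function.update ρ v m .x) (Function.update ρ v m .y)) ↔
        g (f w w.length) (Function.update (fun u => f w (ρ u)) v (f w m))
          (match v with | .x => .lt | .y => .gt)) := by
      intro m hm
      have h1 : (fun u => f w (Function.update ρ v m u)) =
          Function.update (fun u => f w (ρ u)) v (f w m) := by
        funext u
        by_cases hu : u = v
        · subst hu; simp
        · simp [Function.update_of_ne hu]
      rw [h1]
      cases v with
      | x =>
        have : compare m (ρ .y) = .lt := compare_lt_iff_lt.2 hm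
        simp [this]
      | y =>
        have : compare (ρ .x) m = .gt := compare_gt_iff_gt.2 hm
        simp [this]
    constructor
    · rintro ⟨m, hm, h⟩
      exact ⟨f w m, ⟨m, hm, rfl⟩, (key m hm).1 h⟩
    · rintro ⟨r, ⟨m, hm, rfl⟩, h⟩
      exact ⟨m, hm, (key m hm).2 h⟩
  | ex v φ ih =>
    obtain ⟨Q, hQ, f, g, hf, hg⟩ := ih hφ.1
    -- As `v` is the only free variable, both variables may be moved to the witness, which makes the
    -- order `.eq`; the enriched type just beyond the end records the types of all positions.
    refine ⟨Q × (Q → Prop), inferInstance, fun w n => (f w n, fun q => ∃ m < n, f w m = q),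
      fun e _ _ => ∃ r, e.2 r ∧ g e.1 (fun _ => r) .eq,
      hf.prodMk hf.pastValues, fun w ρ => ?_⟩
    have key : ∀ m, φ.Sat w (Function.update ρ v m) ↔ g (f w w.length) (fun _ => f w m) .eq := by
      intro m
      rw [φ.sat_congr w (ρ' := fun _ => m) (by simp [hφ.2]), hg]
      simp
    simp only [Sat, key]
    constructor
    · rintro ⟨m, hm, h⟩
      exact ⟨f w m, ⟨m, hm, rfl⟩, h⟩
    · rintro ⟨r, ⟨m, hm, rfl⟩, h⟩
      exact ⟨m, hm, h⟩

end PFO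

theorem PTL.definable_eq_PFO_definable {α : Type*} [Nonempty α] :
    PTL.definable α = PFO.definable α := by
  ext L
  constructor
  · rintro ⟨ψ, rfl⟩
    exact ⟨ψ.toSentence, ψ.isFormula_toSentence, ψ.free_toSentence,
      Set.ext fun w => ψ.sat_toSentence w _⟩
  · rintro ⟨φ, h₁, h₂, rfl⟩
    obtain ⟨Q, _, f, g, hf, hg⟩ := φ.exists_type h₁
    -- The assignment is irrelevant for a sentence, so both variables are placed just beyond the
    -- end, where `PTL` formulas are evaluated.
    obtain ⟨ψ, hψ⟩ := hf.pred fun q => g q (fun _ => q) .eq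
    refine ⟨ψ, Set.ext fun w => ?_⟩
    have h : φ.Sat w (fun _ => 0) ↔ φ.Sat w (fun _ => w.length) :=
      φ.sat_congr w (by simp [h₂])
    refine (hψ w w.length).trans (Iff.trans ?_ h.symm)
    rw [hg]
    simp

end

noncomputable section

/-! ### Rounding -/

namespace FloatFormat

variable (F : FloatFormat)

theorem bound_pos : 0 < F.bound := F.lt_bound 0 F.zero_mem

theorem coe_round_of_le {z : EReal} (h : (F.bound : EReal) ≤ z) : (F.round z : EReal) = ⊤ := by
  simp [round, h]

theorem coe_round_of_le_neg {z : EReal} (h : z ≤ ((-F.bound : ℝ) : EReal)) :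
    (F.round z : EReal) = ⊥ := by
  have h' : ¬ (F.bound : EReal) ≤ z := fun h' => by
    have := EReal.coe_le_coe_iff.1 (h'.trans h)
    linarith [F.bound_pos]
  simp only [round, h', h, if_true, if_false]

theorem coe_round_of_lt {z : EReal} (h : ((-F.bound : ℝ) : EReal) < z) (h' : z < F.bound) :
    (F.round z : EReal) = F.nearest z.toReal := by
  simp only [round, not_le.2 h, not_le.2 h', if_false]

theorem nearest_mono : Monotone F.nearest := by
  intro x y hxy
  by_contra! h
  have h₁ := F.nearest_le x _ (F.nearest_mem y)
  have h₂ := F.nearest_le y _ (F.nearest_mem x)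
  have h₃ := sq_le_sq.2 h₁
  have h₄ := sq_le_sq.2 h₂
  -- If the rounded values were in the wrong order, `x` would lie at or above their midpoint and `y`
  -- at or below it, forcing `x = y` whatever the tie-breaking.
  have hx : F.nearest x + F.nearest y ≤ 2 * x := by
    by_contra! hc
    nlinarith
  have hy : 2 * y ≤ F.nearest x + F.nearest y := by
    by_contra! hc
    nlinarith
  have : x = y := by linarith
  exact absurd h (by rw [this]; exact lt_irrefl _)

theorem nearest_eq {x : ℝ} (hx : x ∈ F.vals) : F.nearest x = x := by
  have := F.nearest_le x x hx
  simp only [sub_self, abs_zero, abs_nonpos_iff] at this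
  linarith

theorem round_mono {a b : EReal} (h : a ≤ b) : (F.round a : EReal) ≤ F.round b := by
  rcases le_or_gt (F.bound : EReal) b with hb | hb
  · simp [F.coe_round_of_le hb]
  rcases le_or_gt a ((-F.bound : ℝ) : EReal) with ha | ha
  · simp [F.coe_round_of_le_neg ha]
  rw [F.coe_round_of_lt ha (h.trans_lt hb), F.coe_round_of_lt (ha.trans_le h) hb]
  exact EReal.coe_le_coe_iff.2 (F.nearest_mono
    (EReal.toReal_le_toReal h (ha.trans_le' bot_le).ne' (hb.trans_le le_top).ne))

theorem neg_bound_lt {x : ℝ} (hx : x ∈ F.vals) : -F.bound < x := by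
  linarith [F.lt_bound _ (F.neg_mem x hx)]

theorem round_coe {x : ℝ} (hx : x ∈ F.vals) : (F.round (x : EReal) : EReal) = x := by
  rw [F.coe_round_of_lt (EReal.coe_lt_coe_iff.2 (F.neg_bound_lt hx))
    (EReal.coe_lt_coe_iff.2 (F.lt_bound x hx)), EReal.toReal_coe, F.nearest_eq hx]

theorem round_top : (F.round ⊤ : EReal) = ⊤ := F.coe_round_of_le le_top

theorem round_bot : (F.round ⊥ : EReal) = ⊥ := F.coe_round_of_le_neg bot_le

theorem round_val (a : F.Val) : F.round (a : EReal) = a := by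
  obtain ⟨a, rfl | rfl | ⟨r, hr, rfl⟩⟩ := a
  · exact Subtype.ext F.round_top
  · exact Subtype.ext F.round_bot
  · exact Subtype.ext (F.round_coe hr)

theorem round_zero : (F.round 0 : EReal) = 0 := F.round_coe F.zero_mem

theorem round_one : (F.round 1 : EReal) = 1 := F.round_coe F.one_mem

theorem round_nonneg {z : EReal} (h : 0 ≤ z) : (0 : EReal) ≤ F.round z := by
  simpa only [F.round_zero] using F.round_mono h

theorem finite_setOf_val : {x : EReal | x = ⊤ ∨ x = ⊥ ∨ ∃ r ∈ F.vals, x = (r : EReal)}.Finite := by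
  have : {x : EReal | x = ⊤ ∨ x = ⊥ ∨ ∃ r ∈ F.vals, x = (r : EReal)} =
      {⊤, ⊥} ∪ (fun r : ℝ => (r : EReal)) '' (F.vals : Set ℝ) := by
    ext x
    simp [eq_comm, or_assoc]
  rw [this]
  exact (Set.toFinite _).union (F.vals.finite_toSet.image _)

instance finite_val : Finite F.Val := F.finite_setOf_val.to_subtype

/-- Finiteness of the format excludes arbitrarily small positive weights, so that sufficiently many
of them always overflow. -/
theorem exists_pos_le : ∃ ε : ℝ, 0 < ε ∧ ∀ x : F.Val, (0 : EReal) < x → (ε : EReal) ≤ x := by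
  classical
  obtain ⟨m, hm, hmin⟩ := (F.vals.filter fun x => 0 < x).exists_min_image id
    ⟨1, by simp [F.one_mem]⟩
  refine ⟨m, (Finset.mem_filter.1 hm).2, ?_⟩
  rintro ⟨x, rfl | rfl | ⟨r, hr, rfl⟩⟩ hx
  · exact le_top
  · simp at hx
  · exact EReal.coe_le_coe_iff.2 (hmin r (by simpa [hr] using hx))

end FloatFormat

/-! ### Transformers on infinite sequences -/

section Sequences

variable {F : FloatFormat} {D N : ℕ}

/-- `IsMaxScore` for scores (at a fixed position `n`) of a sequence of positions. -/
def IsMaxScoreSeq (S : ℕ → F.Val) (n m : ℕ) : Prop := ∀ i < n, (S i : EReal) ≤ (S m : EReal)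

open Classical in
/-- `attentionWeight` for scores (at a fixed position `n`) of a sequence of positions. -/
def attentionWeightSeq (S : ℕ → F.Val) (n m : ℕ) : AttentionKind → F.Val
  | .soft =>
      F.round ((F.expo (S m) : EReal) /
        (F.round (∑ i ∈ Finset.range n, (F.expo (S i) : EReal)) : EReal))
  | .averageHard =>
      F.round ((if IsMaxScoreSeq S n m then (1 : EReal) else 0) /
        (F.round (∑ j ∈ Finset.range n, if IsMaxScoreSeq S n j then (1 : EReal) else 0) : EReal))
  | .uniqueHard =>
      F.round (if IsMaxScoreSeq S n m ∧ ∀ i < n, IsMaxScoreSeq S n i → i ≤ m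
        then (1 : EReal) else 0)

namespace TransformerLayer

variable (ℓ : TransformerLayer F D)

/-- The score of a key vector `v` for a query vector `u`. -/
def scoreVec (u v : Fin D → F.Val) : F.Val :=
  F.round ((F.dot (F.mulVec ℓ.WQ u) (F.mulVec ℓ.WK v) : EReal) /
    ((Real.sqrt (D : ℝ) : ℝ) : EReal))

/-- The attention sublayer on a sequence. -/
def attentionSeq (A : AttentionKind) (X : ℕ → Fin D → F.Val) (n : ℕ) : Fin D → F.Val :=
  fun d => F.round (∑ m ∈ Finset.range n,
    (F.round ((attentionWeightSeq (fun i => ℓ.scoreVec (X n) (X i)) n m A : EReal) *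
      (F.mulVec ℓ.WV (X m) d : EReal)) : EReal))

/-- The position-wise part of a layer: both normalizations and the feedforward sublayer, for the
value `a` of the attention sublayer. -/
def pointwise (a v : Fin D → F.Val) : Fin D → F.Val :=
  let y := F.layerNorm ℓ.gain₁ ℓ.bias₁ (F.vadd a v)
  F.layerNorm ℓ.gain₂ ℓ.bias₂ (F.vadd (ℓ.feedforward y) y)

/-- A hidden layer on a sequence. -/
def applySeq (A : AttentionKind) (X : ℕ → Fin D → F.Val) (n : ℕ) : Fin D → F.Val :=
  ℓ.pointwise (ℓ.attentionSeq A X n) (X n)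

end TransformerLayer

theorem sum_Iio_eq_sum_range {M : Type*} [AddCommMonoid M] (n : Fin N) (f : ℕ → M) :
    ∑ m ∈ Finset.Iio n, f m = ∑ m ∈ Finset.range n, f m := by
  rw [← Nat.Iio_eq_range, ← Fin.map_valEmbedding_Iio, Finset.sum_map]
  rfl

theorem isMaxScore_iff (S : Fin N → ℕ → F.Val) (n m : Fin N) :
    IsMaxScore F (fun i j => S i j) n m ↔ IsMaxScoreSeq (S n) n m :=
  ⟨fun h i hi => h ⟨i, hi.trans n.2⟩ hi, fun h i hi => h i hi⟩

theorem attentionWeight_eq (S : Fin N → ℕ → F.Val) (n m : Fin N) (A : AttentionKind) :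
    attentionWeight F (fun i j => S i j) n m A = attentionWeightSeq (S n) n m A := by
  classical
  cases A with
  | soft =>
    simp only [attentionWeight, attentionWeightSeq]
    rw [sum_Iio_eq_sum_range n fun i => (F.expo (S n i) : EReal)]
  | averageHard =>
    simp only [attentionWeight, attentionWeightSeq, isMaxScore_iff]
    rw [sum_Iio_eq_sum_range n fun i => if IsMaxScoreSeq (S n) n i then (1 : EReal) else 0]
  | uniqueHard =>
    simp only [attentionWeight, attentionWeightSeq, isMaxScore_iff]
    congr 2
    exact propext (and_congr_right fun _ =>
      ⟨fun h i hi => h ⟨i, hi.trans n.2⟩ hi, fun h i hi => h i hi⟩)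

/-- Strict masking makes position `n` independent of everything after it, so a finite input may be
treated as the start of an infinite sequence, without types that depend on its length. -/
theorem TransformerLayer.apply_eq (ℓ : TransformerLayer F D) (A : AttentionKind)
    (X : ℕ → Fin D → F.Val) (n : Fin N) :
    ℓ.apply A (fun i : Fin N => X i) n = ℓ.applySeq A X n := by
  have h : ℓ.attention A (fun i : Fin N => X i) n = ℓ.attentionSeq A X n := by
    funext d
    simp only [attention, attentionSeq]
    rw [← sum_Iio_eq_sum_range n fun m => (F.round
      ((attentionWeightSeq (fun i => ℓ.scoreVec (X n) (X i)) n m A : EReal) *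
      (F.mulVec ℓ.WV (X m) d : EReal)) : EReal)]
    congr 1
    refine Finset.sum_congr rfl fun m _ => ?_
    rw [← attentionWeight_eq (fun i j => ℓ.scoreVec (X i) (X j)) n m A]
    rfl
  simp only [apply, applySeq, pointwise, h]

/-- A stack of layers on a sequence. -/
def runSeq (A : AttentionKind) (L : List (TransformerLayer F D)) (X : ℕ → Fin D → F.Val) :
    ℕ → Fin D → F.Val := L.foldl (fun X ℓ => ℓ.applySeq A X) X

theorem foldl_apply_eq (A : AttentionKind) (L : List (TransformerLayer F D))
    (X : ℕ → Fin D → F.Val) :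
    L.foldl (fun (X : Fin N → Fin D → F.Val) ℓ => ℓ.apply A X) (fun i => X i) =
      fun i : Fin N => runSeq A L X i := by
  induction L generalizing X with
  | nil => rfl
  | cons ℓ L ih =>
    simp only [List.foldl_cons, runSeq]
    rw [show ℓ.apply A (fun i : Fin N => X i) = fun i : Fin N => ℓ.applySeq A X i from
      funext fun n => ℓ.apply_eq A X n, ih]
    rfl

/-- The value `E none` used beyond the end of the string is arbitrary: masking hides it from the
actual positions. -/
theorem Transformer.final_eq {α : Type*} (T : Transformer F α) (A : AttentionKind) (w : List α)
    (E : Option (Option α) → Fin T.dim → F.Val) (hE : ∀ a, E (some a) = T.embed a)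
    (n : Fin (withEOS w).length) :
    T.final A w n = runSeq A T.layers (fun i => E (withEOS w)[i]?) n := by
  have h := congrFun (foldl_apply_eq (N := (withEOS w).length) A T.layers
    fun i => E (withEOS w)[i]?) n
  rw [← h, final]
  funext i
  simp [hE]

end Sequences

/-! ### Languages and the end-of-sentence symbol -/

theorem getElem?_withEOS {α : Type*} (w : List α) (n : ℕ) :
    (withEOS w)[n]? = if n < w.length then w[n]?.map some
      else if n = w.length then some none else none := by
  unfold withEOS
  split_ifs with h₁ h₂
  · rw [List.getElem?_append_left (by simpa using h₁)]
    simp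
  · subst h₂
    simp
  · simp
    omega

namespace PTL

variable {α : Type*}

/-- A formula over the extended alphabet, restricted to positions before the end. -/
def beforeEOS (a₀ : α) : PTL (Option α) → PTL α
  | atom (some a) => atom a
  | atom none => and (atom a₀) (not (atom a₀))
  | and φ ψ => and (φ.beforeEOS a₀) (ψ.beforeEOS a₀)
  | not φ => not (φ.beforeEOS a₀)
  | past φ => past (φ.beforeEOS a₀)

/-- A formula over the extended alphabet, at the end-of-sentence symbol. -/
def atEOS (a₀ : α) : PTL (Option α) → PTL α
  | atom (some _) => and (atom a₀) (not (atom a₀))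
  | atom none => not (and (atom a₀) (not (atom a₀)))
  | and φ ψ => and (φ.atEOS a₀) (ψ.atEOS a₀)
  | not φ => not (φ.atEOS a₀)
  | past φ => past (φ.beforeEOS a₀)

theorem sat_beforeEOS (a₀ : α) (ψ : PTL (Option α)) (w : List α) {n : ℕ} (hn : n < w.length) :
    (ψ.beforeEOS a₀).Sat w n ↔ ψ.Sat (withEOS w) n := by
  induction ψ generalizing n with
  | atom a => cases a <;> simp [beforeEOS, Sat, getElem?_withEOS, hn]
  | and φ ψ h₁ h₂ => simp [beforeEOS, Sat, h₁ hn, h₂ hn]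
  | not φ h => simp [beforeEOS, Sat, h hn]
  | past φ h =>
    simp only [beforeEOS, Sat]
    exact exists_congr fun m => and_congr_right fun hm => h (hm.trans hn)

theorem sat_atEOS (a₀ : α) (ψ : PTL (Option α)) (w : List α) :
    (ψ.atEOS a₀).Sat w w.length ↔ ψ.Sat (withEOS w) w.length := by
  induction ψ with
  | atom a => cases a <;> simp [atEOS, Sat, getElem?_withEOS]
  | and φ ψ h₁ h₂ => simp [atEOS, Sat, h₁, h₂]
  | not φ h => simp [atEOS, Sat, h]
  | past φ h =>
    simp only [atEOS, Sat]
    exact exists_congr fun m => and_congr_right fun hm => φ.sat_beforeEOS a₀ w hm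

/-- The same formula over the extended alphabet. -/
def extend : PTL α → PTL (Option α)
  | atom a => atom (some a)
  | and φ ψ => and φ.extend ψ.extend
  | not φ => not φ.extend
  | past φ => past φ.extend

theorem sat_extend (ψ : PTL α) (w : List α) {n : ℕ} (hn : n ≤ w.length) :
    ψ.extend.Sat (withEOS w) n ↔ ψ.Sat w n := by
  induction ψ generalizing n with
  | atom a =>
    rcases hn.lt_or_eq with h | rfl
    · simp [extend, Sat, getElem?_withEOS, h]
    · simp [extend, Sat, getElem?_withEOS]
  | and φ ψ h₁ h₂ => simp [extend, Sat, h₁ hn, h₂ hn]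
  | not φ h => simp [extend, Sat, h hn]
  | past φ h =>
    simp only [extend, Sat]
    exact exists_congr fun m => and_congr_right fun hm => h (hm.le.trans hn)

/-- The end symbol occupies the position just beyond the end of `w`, so letter tests there are
constants and everything earlier concerns letters of `α`. -/
theorem Definable.mem_definable [Nonempty α] {p : List (Option α) → ℕ → Prop} (hp : Definable p) :
    ({w | p (withEOS w) w.length} : Language α) ∈ PTL.definable α := by
  obtain ⟨ψ, hψ⟩ := hp
  obtain ⟨a₀⟩ := ‹Nonempty α›
  exact ⟨ψ.atEOS a₀, Set.ext fun w => (ψ.sat_atEOS a₀ w).trans (hψ _ _)⟩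

end PTL

end

noncomputable section

/-! ### Average hard and soft attention are definable in `PTL` -/

section Upper

variable {F : FloatFormat} {D : ℕ} {Q : Type*}

theorem sum_range_comp_eq [Fintype Q] (X : ℕ → Q) (n : ℕ) (f : Q → EReal) :
    ∑ m ∈ Finset.range n, f (X m) = ∑ q, PTL.countBefore (fun m => X m = q) n • f q := by
  classical
  rw [← Finset.sum_fiberwise (s := Finset.range n) (g := X)]
  refine Finset.sum_congr rfl fun q _ => ?_
  rw [Finset.sum_congr rfl fun m hm => by rw [(Finset.mem_filter.1 hm).2], Finset.sum_const]
  unfold PTL.countBefore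
  congr!

/-- A single value repeated `T` times already pushes the normalizer beyond the overflow threshold,
because the other terms are nonnegative. -/
theorem le_sum_range_comp (X : ℕ → Q) (n : ℕ) (e : Q → EReal) (he : ∀ q, 0 ≤ e q) {q : Q}
    {ε b : ℝ} {T : ℕ} (hq : (ε : EReal) ≤ e q) (hT : b ≤ T * ε)
    (hc : T ≤ PTL.countBefore (fun m => X m = q) n) :
    (b : EReal) ≤ ∑ m ∈ Finset.range n, e (X m) := by
  classical
  obtain ⟨s, hs, hcard⟩ := Finset.exists_subset_card_eq hc
  have hs' : s ⊆ Finset.range n := hs.trans (Finset.filter_subset _ _)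
  calc (b : EReal) ≤ ((T * ε : ℝ) : EReal) := EReal.coe_le_coe_iff.2 hT
    _ = ∑ m ∈ s, (ε : EReal) := by
        rw [Finset.sum_const, hcard, ← EReal.coe_nsmul, nsmul_eq_mul]
    _ ≤ ∑ m ∈ s, e (X m) := Finset.sum_le_sum fun m hm => by
        rw [(Finset.mem_filter.1 (hs hm)).2]; exact hq
    _ ≤ ∑ m ∈ Finset.range n, e (X m) :=
        Finset.sum_le_sum_of_subset_of_nonneg hs' fun m _ _ => he _

/-- A weighted average in fixed precision depends only on the truncated numbers of occurrences. -/
theorem weighted_sum_congr [Fintype Q] {ε : ℝ} {T : ℕ} (hT : F.bound ≤ T * ε)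
    {e : Q → EReal} (he : ∀ q, e q = 0 ∨ (0 ≤ e q ∧ (ε : EReal) ≤ e q)) (V : Q → EReal)
    {X X' : ℕ → Q} {n n' : ℕ}
    (h : ∀ q, ∀ k < T, k < PTL.countBefore (fun m => X m = q) n ↔
      k < PTL.countBefore (fun m => X' m = q) n') :
    ∑ m ∈ Finset.range n, (F.round ((F.round (e (X m) /
        (F.round (∑ i ∈ Finset.range n, e (X i)) : EReal)) : EReal) * V (X m)) : EReal) =
      ∑ m ∈ Finset.range n', (F.round ((F.round (e (X' m) /
        (F.round (∑ i ∈ Finset.range n', e (X' i)) : EReal)) : EReal) * V (X' m)) : EReal) := by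
  have he0 : ∀ q, 0 ≤ e q := fun q => (he q).elim (fun h => h.ge) fun h => h.1
  -- In the first case both normalizers overflow to `∞`, and division by `∞` makes both sums zero.
  by_cases hbig : ∃ q, e q ≠ 0 ∧ T ≤ PTL.countBefore (fun m => X m = q) n
  · obtain ⟨q, hq, hc⟩ := hbig
    have hq' := ((he q).resolve_left hq).2
    have hc' : T ≤ PTL.countBefore (fun m => X' m = q) n' := by
      by_contra! hlt
      have := (h q _ hlt).1 (hlt.trans_le hc)
      exact lt_irrefl _ this
    rw [F.coe_round_of_le (le_sum_range_comp X n e he0 hq' hT hc),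
      F.coe_round_of_le (le_sum_range_comp X' n' e he0 hq' hT hc')]
    simp [F.round_zero]
  · push Not at hbig
    -- Below the threshold truncated multiplicities are exact; multiplicities of vectors with weight
    -- zero need not agree, as these contribute nothing.
    have hcount : ∀ q, e q ≠ 0 → PTL.countBefore (fun m => X m = q) n =
        PTL.countBefore (fun m => X' m = q) n' := by
      intro q hq
      have hlt := hbig q hq
      have h₁ := h q _ hlt
      simp only [lt_irrefl, false_iff, not_lt] at h₁
      have h₂ := h q _ (h₁.trans_lt hlt)
      simp only [lt_irrefl, iff_false, not_lt] at h₂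
      omega
    have hsum : ∀ f : Q → EReal, (∀ q, e q = 0 → f q = 0) →
        ∑ m ∈ Finset.range n, f (X m) = ∑ m ∈ Finset.range n', f (X' m) := by
      intro f hf
      rw [sum_range_comp_eq, sum_range_comp_eq]
      refine Finset.sum_congr rfl fun q _ => ?_
      by_cases hq : e q = 0
      · simp [hf q hq]
      · rw [hcount q hq]
    rw [hsum e fun _ h => h]
    exact hsum (fun q => (F.round ((F.round (e q /
        (F.round (∑ i ∈ Finset.range n', e (X' i)) : EReal)) : EReal) * V q) : EReal))
        fun q hq => by simp [hq, F.round_zero]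

theorem FloatFormat.expo_nonneg (a : F.Val) : (0 : EReal) ≤ F.expo a :=
  F.round_nonneg (EReal.coe_ennreal_nonneg _)

theorem exists_lt_iff_countBefore_pos (X : ℕ → Q) (n : ℕ) (q : Q) :
    0 < PTL.countBefore (fun m => X m = q) n ↔ ∃ m < n, X m = q := by
  simp [PTL.countBefore, Finset.card_pos, Finset.Nonempty]

/-- Soft and average hard attention depend only on the query and on the truncated numbers of
occurrences of vectors before the current position. -/
theorem exists_attentionSeq_congr (F : FloatFormat) :
    ∃ T : ℕ, ∀ {D : ℕ} (ℓ : TransformerLayer F D) {A : AttentionKind}, A ≠ .uniqueHard →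
      ∀ {X X' : ℕ → Fin D → F.Val} {n n' : ℕ}, X n = X' n' →
      (∀ q, ∀ k < T, k < PTL.countBefore (fun m => X m = q) n ↔
        k < PTL.countBefore (fun m => X' m = q) n') →
      ℓ.attentionSeq A X n = ℓ.attentionSeq A X' n' := by
  classical
  obtain ⟨ε, hε, hmin⟩ := F.exists_pos_le
  have hε1 : (ε : EReal) ≤ 1 := by
    have := hmin (F.round 1) (by rw [F.round_one]; exact zero_lt_one)
    rwa [F.round_one] at this
  obtain ⟨T, hT⟩ := exists_nat_ge (F.bound / ε)
  have hT' : F.bound ≤ T * ε := (div_le_iff₀ hε).1 hT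
  -- Positivity ensures that the truncated counts tell which vectors occur, and hence what the
  -- maximum score is.
  have hT0 : 0 < T := by
    rw [← Nat.cast_pos (α := ℝ)]
    exact (div_pos F.bound_pos hε).trans_le hT
  refine ⟨T, fun {D} ℓ {A} hA {X X' n n'} hX h => ?_⟩
  have := Fintype.ofFinite (Fin D → F.Val)
  funext d
  simp only [TransformerLayer.attentionSeq]
  congr 1
  cases A with
  | uniqueHard => exact absurd rfl hA
  | soft =>
    rw [hX]
    exact weighted_sum_congr hT' (e := fun q => (F.expo (ℓ.scoreVec (X' n') q) : EReal))
      (fun q => (F.expo_nonneg _).eq_or_lt.imp (fun h => h.symm) fun h => ⟨h.le, hmin _ h⟩)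
      (fun q => (F.mulVec ℓ.WV q d : EReal)) h
  | averageHard =>
    rw [hX]
    set u := X' n'
    -- Maximality of a score depends only on the vector and on the set of vectors that occur, so
    -- average hard attention becomes a weighted average like the soft one.
    set e : (Fin D → F.Val) → EReal := fun q =>
      if ∀ r, (∃ m < n', X' m = r) → (ℓ.scoreVec u r : EReal) ≤ ℓ.scoreVec u q then 1 else 0
    have he : ∀ q, e q = 0 ∨ (0 ≤ e q ∧ (ε : EReal) ≤ e q) := by
      intro q
      simp only [e]
      split_ifs
      · exact Or.inr ⟨zero_le_one, hε1⟩
      · exact Or.inl rfl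
    have h₁ : ∀ m, (if IsMaxScoreSeq (fun i => ℓ.scoreVec u (X i)) n m then (1 : EReal) else 0) =
        e (X m) := by
      intro m
      refine if_congr ?_ rfl rfl
      have hs : ∀ r, (∃ m < n, X m = r) ↔ ∃ m < n', X' m = r := fun r => by
        rw [← exists_lt_iff_countBefore_pos, ← exists_lt_iff_countBefore_pos, h r 0 hT0]
      simp only [← hs]
      exact ⟨fun h r ⟨i, hi, hr⟩ => hr ▸ h i hi, fun h i hi => h _ ⟨i, hi, rfl⟩⟩
    have h₂ : ∀ m, (if IsMaxScoreSeq (fun i => ℓ.scoreVec u (X' i)) n' m then (1 : EReal) else 0) =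
        e (X' m) := by
      intro m
      refine if_congr ?_ rfl rfl
      exact ⟨fun h r ⟨i, hi, hr⟩ => hr ▸ h i hi, fun h i hi => h _ ⟨i, hi, rfl⟩⟩
    simp only [attentionWeightSeq, h₁, h₂]
    exact weighted_sum_congr hT' he (fun q => (F.mulVec ℓ.WV q d : EReal)) h

/-! ### Definability through the layers -/

namespace PTL

variable {β : Type*} [Nonempty β] {A : AttentionKind}

/-- The current vector and the truncated counts of all vectors form one definable function with
finitely many values, and the output of the layer factors through it. -/
theorem DefinableFun.applySeq (hA : A ≠ .uniqueHard) (ℓ : TransformerLayer F D)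
    {X : List β → ℕ → Fin D → F.Val} (hX : DefinableFun X) :
    DefinableFun fun w => ℓ.applySeq A (X w) := by
  obtain ⟨T, hT⟩ := exists_attentionSeq_congr F
  have h := hX.prodMk (DefinableFun.pi fun p : (Fin D → F.Val) × Fin T =>
    ((hX p.1).lt_countBefore p.2).definableFun)
  refine h.of_factors fun w n w' n' heq => ?_
  obtain ⟨h₁, h₂⟩ := Prod.mk.inj heq
  simp only [TransformerLayer.applySeq]
  rw [hT ℓ hA h₁ fun q k hk => iff_of_eq (congrFun h₂ (q, ⟨k, hk⟩)), h₁]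

theorem DefinableFun.runSeq (hA : A ≠ .uniqueHard) (L : List (TransformerLayer F D))
    {X : List β → ℕ → Fin D → F.Val} (hX : DefinableFun X) :
    DefinableFun fun w => runSeq A L (X w) := by
  induction L generalizing X with
  | nil => exact hX
  | cons ℓ L ih => exact ih (hX.applySeq hA ℓ)

end PTL

namespace Transformer

variable {α : Type*} [Finite α] {A : AttentionKind}

theorem exists_definableFun_final (hA : A ≠ .uniqueHard) (T : Transformer F α) :
    ∃ X : List (Option α) → ℕ → Fin T.dim → F.Val, PTL.DefinableFun X ∧
      ∀ (w : List α) (n : Fin (withEOS w).length), T.final A w n = X (withEOS w) n := by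
  refine ⟨fun w => runSeq A T.layers fun i => T.embed (w[i]?.getD none),
    PTL.DefinableFun.runSeq hA _ ?_, fun w n =>
      T.final_eq A w (fun a => T.embed (a.getD none)) (fun _ => rfl) n⟩
  exact PTL.definableFun_letter.comp fun a => T.embed (a.getD none)

theorem simulatedByPFO (hA : A ≠ .uniqueHard) (T : Transformer F α) : T.SimulatedByPFO A := by
  obtain ⟨X, hX, h⟩ := T.exists_definableFun_final hA
  refine ⟨fun d f => ?_, fun f => ?_⟩
  · obtain ⟨ψ, hψ⟩ := hX.comp (fun v => v d) f
    exact ⟨ψ.toPFO .x, ψ.isFormula_toPFO _, ψ.isBounded_toPFO _, ψ.free_toPFO _, fun w n => by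
      rw [PTL.sat_toPFO, hψ, h]⟩
  · obtain ⟨ψ, hψ⟩ := hX.comp (fun v => F.round ((F.dot T.headWeight v : EReal) +
      (T.headBias : EReal))) f
    refine ⟨ψ.toPFO .x, ψ.isFormula_toPFO _, ψ.isBounded_toPFO _, ψ.free_toPFO _, fun w => ?_⟩
    rw [PTL.sat_toPFO, hψ, output, h]

theorem recognizable_subset_definable [Nonempty α] (hA : A ≠ .uniqueHard) :
    recognizable F A α ⊆ PTL.definable α := by
  rintro _ ⟨T, rfl⟩
  obtain ⟨X, hX, h⟩ := T.exists_definableFun_final hA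
  have hL : T.language A = {w | (0 : EReal) < F.round ((F.dot T.headWeight
      (X (withEOS w) w.length) : EReal) + (T.headBias : EReal))} :=
    Set.ext fun w => by simp only [language, output, h]; rfl
  rw [hL]
  exact (hX.pred fun v => (0 : EReal) < F.round ((F.dot T.headWeight v : EReal) +
    (T.headBias : EReal))).mem_definable

end Transformer

end Upper

end

noncomputable section

/-! ### Layer normalization that acts as the identity -/

-- Only finitely many values compete with `x`, each strictly farther from it, and the overflow
-- thresholds are also at positive distance; ties therefore play no role near `x`.
open Filter Topology in
theorem FloatFormat.eventually_round_eq (F : FloatFormat) {x : ℝ} (hx : x ∈ F.vals) :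
    ∀ᶠ y : ℝ in 𝓝 x, (F.round (y : EReal) : EReal) = x := by
  have h₁ : ∀ᶠ y : ℝ in 𝓝 x, ∀ z ∈ F.vals, z ≠ x → |y - x| < |y - z| := by
    refine (eventually_all_finset F.vals).2 fun z _ => ?_
    by_cases hz : z = x
    · simp [hz]
    · have : Tendsto (fun y : ℝ => |y - z| - |y - x|) (𝓝 x) (𝓝 (|x - z| - |x - x|)) :=
        (Continuous.tendsto (by fun_prop) x)
      have hpos : 0 < |x - z| - |x - x| := by
        simpa using sub_ne_zero.2 (Ne.symm hz)
      filter_upwards [this.eventually (lt_mem_nhds hpos)] with y hy _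
      linarith
  filter_upwards [h₁, lt_mem_nhds (F.neg_bound_lt hx), gt_mem_nhds (F.lt_bound x hx)]
    with y hy hy₁ hy₂
  rw [F.coe_round_of_lt (EReal.coe_lt_coe_iff.2 hy₁) (EReal.coe_lt_coe_iff.2 hy₂),
    EReal.toReal_coe]
  by_contra hne
  have hne' : F.nearest y ≠ x := fun h => hne (by rw [h])
  exact absurd (F.nearest_le y x hx) (not_le.2 (hy _ (F.nearest_mem y) hne'))

section Registers

variable {R : Type*} {M : ℕ} (F : FloatFormat)

/-- Coordinates: one for each register, and `M` pairs of constants `1` and `-1`. -/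
abbrev Coord (R : Type*) (M : ℕ) : Type _ := R ⊕ (Fin M × Bool)

/-- The value of a coordinate, given the contents of the registers. -/
def coordVal (x : R → ℝ) : Coord R M → ℝ := Sum.elim x fun q => if q.2 then 1 else -1

variable {F} in
theorem coordVal_mem {x : R → ℝ} (hx : ∀ r, x r ∈ F.vals) (c : Coord R M) :
    coordVal x c ∈ F.vals := by
  rcases c with r | ⟨_, _ | _⟩
  · exact hx r
  · simpa [coordVal] using F.neg_mem 1 F.one_mem
  · simpa [coordVal] using F.one_mem

variable [Fintype R]

/-- The width of a transformer with registers `R` and `M` pairs of constants. -/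
abbrev width (R : Type*) [Fintype R] (M : ℕ) : ℕ := Fintype.card (Coord R M)

/-- Enumeration of the coordinates. -/
def coordEquiv : Coord R M ≃ Fin (width R M) := Fintype.equivFin _

/-- The vector with given contents of the registers. -/
def registerVec (x : R → ℝ) : Fin (width R M) → F.Val :=
  fun i => F.round (coordVal x (coordEquiv.symm i) : ℝ)

variable {F}

theorem coe_registerVec {x : R → ℝ} (hx : ∀ r, x r ∈ F.vals) (i : Fin (width R M)) :
    (registerVec F x i : EReal) = coordVal x (coordEquiv.symm i) :=
  F.round_coe (coordVal_mem hx _)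

theorem EReal.coe_sum {ι : Type*} (s : Finset ι) (f : ι → ℝ) :
    ((∑ i ∈ s, f i : ℝ) : EReal) = ∑ i ∈ s, (f i : EReal) := by
  classical
  induction s using Finset.induction_on with
  | empty => simp
  | insert i s hi ih => rw [Finset.sum_insert hi, Finset.sum_insert hi, EReal.coe_add, ih]

theorem EReal.sqrtNonneg_coe (r : ℝ) :
    EReal.sqrtNonneg (r : EReal) = (Real.sqrt r : ℝ) := by
  unfold EReal.sqrtNonneg
  rw [EReal.toENNReal_of_ne_top (EReal.coe_ne_top _), EReal.toReal_coe]
  rcases le_total 0 r with hr | hr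
  · rw [ENNReal.ofReal_rpow_of_nonneg hr (by norm_num), Real.sqrt_eq_rpow,
      EReal.coe_ennreal_ofReal, max_eq_left (Real.rpow_nonneg hr _)]
  · rw [ENNReal.ofReal_of_nonpos hr, Real.sqrt_eq_zero_of_nonpos hr,
      ENNReal.zero_rpow_of_pos (by norm_num)]
    simp

/-- The mean of the coordinates. -/
def coordMean (M : ℕ) (x : R → ℝ) : ℝ := (∑ c : Coord R M, coordVal x c) / width R M

/-- The standard deviation of the coordinates. -/
def coordDev (M : ℕ) (x : R → ℝ) : ℝ :=
  Real.sqrt ((∑ c : Coord R M, (coordVal x c - coordMean M x) * (coordVal x c - coordMean M x)) /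
    width R M)

theorem coe_layerNorm_registerVec {x : R → ℝ} (hx : ∀ r, x r ∈ F.vals) (i : Fin (width R M)) :
    (F.layerNorm (fun _ => F.round 1) (fun _ => F.round 0) (registerVec F x) i : EReal) =
      F.round (((coordVal x (coordEquiv.symm i) - coordMean M x) / coordDev M x : ℝ) : EReal) := by
  have hμ : (∑ i : Fin (width R M), (registerVec F x i : EReal)) / ((width R M : ℕ) : EReal) =
      (coordMean M x : ℝ) := by
    rw [coordMean, EReal.coe_div, EReal.coe_sum, ← coordEquiv.symm.sum_comp]
    simp only [coe_registerVec hx]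
    rfl
  simp only [FloatFormat.layerNorm, hμ, F.round_one, F.round_zero, one_mul, add_zero]
  have hσ : EReal.sqrtNonneg ((∑ i : Fin (width R M), ((registerVec F x i : EReal) - (coordMean M x : ℝ)) *
      ((registerVec F x i : EReal) - (coordMean M x : ℝ))) / ((width R M : ℕ) : EReal)) =
      (coordDev M x : ℝ) := by
    rw [coordDev, ← EReal.sqrtNonneg_coe, EReal.coe_div, EReal.coe_sum,
      ← coordEquiv.symm.sum_comp]
    simp only [coe_registerVec hx, EReal.coe_mul, EReal.coe_sub]
    rfl
  rw [hσ, coe_registerVec hx, EReal.coe_div, EReal.coe_sub]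

/-! ### Mean and deviation under growing padding -/

open Filter Topology

theorem width_eq (M : ℕ) : (width R M : ℝ) = Fintype.card R + M * 2 := by
  simp [width]

theorem tendsto_width : Tendsto (fun M : ℕ => (width R M : ℝ)) atTop atTop := by
  simp only [width_eq]
  exact tendsto_atTop_add_const_left _ _
    (tendsto_natCast_atTop_atTop.atTop_mul_const (by norm_num))

theorem coordMean_eq (M : ℕ) (x : R → ℝ) : coordMean M x = (∑ r, x r) / width R M := by
  simp [coordMean, coordVal, Fintype.sum_sum_type, Fintype.sum_prod_type]

theorem tendsto_coordMean (x : R → ℝ) : Tendsto (fun M => coordMean M x) atTop (𝓝 0) := by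
  simp only [coordMean_eq]
  exact tendsto_width.const_div_atTop _

theorem tendsto_coordDev (x : R → ℝ) : Tendsto (fun M => coordDev M x) atTop (𝓝 1) := by
  have hμ := tendsto_coordMean x
  -- Each pair of constants contributes `(1 - μ)² + (-1 - μ)² = 2 * (1 + μ²)`, which dominates the
  -- fixed number of registers.
  have h₁ : ∀ M : ℕ, (∑ c : Coord R M, (coordVal x c - coordMean M x) *
      (coordVal x c - coordMean M x)) = ∑ r, (x r - coordMean M x) * (x r - coordMean M x) +
      M * 2 * (1 + coordMean M x ^ 2) := by
    intro M
    simp [coordVal, Fintype.sum_sum_type, Fintype.sum_prod_type]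
    ring
  have h₂ : Tendsto (fun M : ℕ => ((M : ℝ) * 2) / width R M) atTop (𝓝 1) := by
    have : Tendsto (fun M : ℕ => 1 - (Fintype.card R : ℝ) / width R M) atTop (𝓝 (1 - 0)) :=
      tendsto_const_nhds.sub (tendsto_width.const_div_atTop _)
    rw [sub_zero] at this
    refine this.congr' ?_
    filter_upwards [tendsto_width (R := R).eventually_gt_atTop 0] with M hM
    rw [eq_div_iff hM.ne', sub_mul, div_mul_cancel₀ _ hM.ne', width_eq]
    ring
  have h₃ : Tendsto (fun M : ℕ => (∑ r, (x r - coordMean M x) * (x r - coordMean M x)) /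
      width R M) atTop (𝓝 0) :=
    (tendsto_finsetSum _ fun r _ => (tendsto_const_nhds.sub hμ).mul
      (tendsto_const_nhds.sub hμ)).div_atTop tendsto_width
  have h₄ := h₃.add (h₂.mul (tendsto_const_nhds (x := (1 : ℝ)).add (hμ.pow 2)))
  have h₅ := h₄.sqrt
  rw [show Real.sqrt (0 + 1 * (1 + 0 ^ 2)) = 1 by norm_num] at h₅
  refine h₅.congr fun M => ?_
  rw [coordDev, h₁, add_div, mul_div_right_comm ((M : ℝ) * 2) (1 + coordMean M x ^ 2)]

/-- With enough constants, layer normalization does not change the registers. -/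
def GoodPadding (F : FloatFormat) (R : Type*) [Fintype R] (M : ℕ) : Prop :=
  ∀ x : R → ℝ, (∀ r, x r ∈ F.vals) →
    F.layerNorm (fun _ => F.round 1) (fun _ => F.round 0) (registerVec (M := M) F x) =
      registerVec F x

theorem exists_goodPadding (F : FloatFormat) (R : Type*) [Fintype R] :
    ∃ M, GoodPadding F R M := by
  have h : ∀ x : R → F.vals, ∀ᶠ M : ℕ in atTop, ∀ y ∈ F.vals,
      (F.round (((y - coordMean M fun r => (x r : ℝ)) / coordDev M fun r => (x r : ℝ) : ℝ) :
        EReal) : EReal) = y := by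
    intro x
    refine (eventually_all_finset F.vals).2 fun y hy => ?_
    have ht : Tendsto (fun M : ℕ => (y - coordMean M fun r => (x r : ℝ)) /
        coordDev M fun r => (x r : ℝ)) atTop (𝓝 ((y - 0) / 1)) :=
      (tendsto_const_nhds.sub (tendsto_coordMean _)).div (tendsto_coordDev _) one_ne_zero
    rw [sub_zero, div_one] at ht
    exact ht.eventually (F.eventually_round_eq hy)
  -- There are only finitely many possible register contents, so one amount of padding serves them
  -- all.
  obtain ⟨M, hM⟩ := (eventually_all.2 h).exists
  refine ⟨M, fun x hx => funext fun i => Subtype.ext ?_⟩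
  rw [coe_layerNorm_registerVec hx, coe_registerVec hx]
  exact hM (fun r => ⟨x r, hx r⟩) _ (coordVal_mem hx _)

end Registers

end

noncomputable section

/-! ### Layers that compute on registers -/

namespace FloatFormat

variable (F : FloatFormat) {k : ℕ}

theorem dot_eq_single {u v : Fin k → F.Val} (i : Fin k)
    (h : ∀ j ≠ i, (u j : EReal) = 0 ∨ (v j : EReal) = 0) :
    F.dot u v = F.round ((u i : EReal) * v i) := by
  unfold dot
  rw [Finset.sum_eq_single i, F.round_val]
  · intro j _ hj
    rcases h j hj with h | h <;> simp [h, F.round_zero]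
  · simp

theorem dot_eq_zero {u v : Fin k → F.Val} (h : ∀ j, (u j : EReal) = 0 ∨ (v j : EReal) = 0) :
    F.dot u v = F.round 0 := by
  unfold dot
  rw [Finset.sum_eq_zero]
  intro j _
  rcases h j with h | h <;> simp [h, F.round_zero]

/-- With `∞ + (-∞) = -∞`, one term `-∞` absorbs all others, whatever they are. -/
theorem dot_eq_bot {u v : Fin k → F.Val} (i : Fin k) (h : (u i : EReal) * v i = ⊥) :
    F.dot u v = F.round ⊥ := by
  unfold dot
  rw [← Finset.add_sum_erase _ _ (Finset.mem_univ i), h, F.round_bot, EReal.bot_add]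

theorem coe_round_nonneg_le {z : ℝ} (h : 0 ≤ z) (h' : z < F.bound) :
    ∃ r ∈ F.vals, 0 ≤ r ∧ (F.round (z : EReal) : EReal) = r := by
  have hz : (F.round (z : EReal) : EReal) = F.nearest z := by
    rw [F.coe_round_of_lt (EReal.coe_lt_coe_iff.2 (by linarith [F.bound_pos]))
      (EReal.coe_lt_coe_iff.2 h'), EReal.toReal_coe]
  refine ⟨_, F.nearest_mem z, ?_, hz⟩
  simpa only [F.nearest_eq F.zero_mem] using F.nearest_mono h

end FloatFormat

section Layers

open Classical

variable {F : FloatFormat} {R : Type*}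

theorem update_mem {x : R → ℝ} (hx : ∀ r, x r ∈ F.vals) (o : R) {y : ℝ} (hy : y ∈ F.vals) (r : R) :
    Function.update x o y r ∈ F.vals := by
  by_cases hr : r = o
  · subst hr; simpa
  · simpa [Function.update_of_ne hr] using hx r

theorem ite_mem_vals (p : Prop) [Decidable p] : (if p then (1 : ℝ) else 0) ∈ F.vals := by
  split_ifs
  exacts [F.one_mem, F.zero_mem]

variable [Fintype R] {M : ℕ}

theorem vadd_registerVec {x y z : R → ℝ} (hx : ∀ r, x r ∈ F.vals)
    (hy : ∀ r, y r ∈ F.vals) {a : Fin (width R M) → F.Val}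
    (ha : ∀ i, (a i : EReal) = (Sum.elim z (fun _ => 0) (coordEquiv.symm i) : ℝ))
    (h : ∀ r, z r + x r = y r) : F.vadd a (registerVec F x) = registerVec F y := by
  funext i
  refine Subtype.ext ?_
  rw [coe_registerVec hy, ← F.round_coe (coordVal_mem hy _), FloatFormat.vadd, ha,
    coe_registerVec hx, ← EReal.coe_add]
  congr 3
  rcases coordEquiv.symm i with r | q
  · exact h r
  · simp [coordVal]

theorem pointwise_registerVec (hM : GoodPadding F R M) {ℓ : TransformerLayer F (width R M)}
    (hg₁ : ℓ.gain₁ = fun _ => F.round 1) (hb₁ : ℓ.bias₁ = fun _ => F.round 0)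
    (hg₂ : ℓ.gain₂ = fun _ => F.round 1) (hb₂ : ℓ.bias₂ = fun _ => F.round 0)
    {a : Fin (width R M) → F.Val} {x y z : R → ℝ}
    (hy : ∀ r, y r ∈ F.vals) (hz : ∀ r, z r ∈ F.vals)
    (h₁ : F.vadd a (registerVec F x) = registerVec F y)
    (h₂ : F.vadd (ℓ.feedforward (registerVec F y)) (registerVec F y) = registerVec F z) :
    ℓ.pointwise a (registerVec F x) = registerVec F z := by
  simp only [TransformerLayer.pointwise, hg₁, hb₁, hg₂, hb₂, h₁, hM y hy, h₂, hM z hz]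

variable (F M) in
/-- A layer that stores in register `o` whether all registers in `S` are zero. -/
def norLayer (S : Finset R) (o : R) : TransformerLayer F (width R M) where
  WQ := fun _ _ => F.round 0
  WK := fun _ _ => F.round 0
  WV := fun _ _ => F.round 0
  gain₁ := fun _ => F.round 1
  bias₁ := fun _ => F.round 0
  hiddenSize := 1
  W₁ := fun _ i => if ∃ r ∈ S, coordEquiv.symm i = .inl r then F.round ⊥ else F.round 0
  b₁ := fun _ => F.round 1
  W₂ := fun i _ => if coordEquiv.symm i = .inl o then F.round 1 else F.round 0
  b₂ := fun _ => F.round 0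
  gain₂ := fun _ => F.round 1
  bias₂ := fun _ => F.round 0

/-- The hidden unit is `ReLU(1 - ∞ * x_r - …)`: the convention `0 * (-∞) = 0` leaves `1` when all
inputs vanish, and any positive input brings it to `0`. A negative input would produce `+∞`, hence
`hS`. -/
theorem norLayer_feedforward {S : Finset R} {o : R} {x : R → ℝ} (hx : ∀ r, x r ∈ F.vals)
    (hS : ∀ r ∈ S, 0 ≤ x r) (i : Fin (width R M)) :
    ((norLayer F M S o).feedforward (registerVec F x) i : EReal) =
      (Sum.elim (fun r => if r = o then (if ∀ r ∈ S, x r = 0 then 1 else 0) else 0) (fun _ => 0)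
        (coordEquiv.symm i) : ℝ) := by
  set u : ℝ := if ∀ r ∈ S, x r = 0 then 1 else 0 with hu
  have hu' : u ∈ F.vals := ite_mem_vals _
  have hW : ∀ j, F.mulVec (norLayer F M S o).W₁ (registerVec F x) j =
      if ∀ r ∈ S, x r = 0 then F.round 0 else F.round ⊥ := by
    intro j
    unfold FloatFormat.mulVec
    split_ifs with h
    · refine F.dot_eq_zero fun i => ?_
      simp only [norLayer]
      split_ifs with hi
      · obtain ⟨r, hr, hi⟩ := hi
        right
        rw [coe_registerVec hx, hi]
        simp [coordVal, h r hr]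
      · exact Or.inl F.round_zero
    · push Not at h
      obtain ⟨r, hr, hne⟩ := h
      refine F.dot_eq_bot (coordEquiv (.inl r)) ?_
      have : (norLayer F M S o).W₁ j (coordEquiv (.inl r)) = F.round ⊥ := by
        simp [norLayer, hr]
      rw [this, F.round_bot, coe_registerVec hx, Equiv.symm_apply_apply]
      exact EReal.bot_mul_coe_of_pos (lt_of_le_of_ne (hS r hr) (Ne.symm hne))
  have hr : ∀ j, (F.relu (F.vadd (F.mulVec (norLayer F M S o).W₁ (registerVec F x))
      (norLayer F M S o).b₁) j : EReal) = u := by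
    intro j
    simp only [FloatFormat.relu, FloatFormat.vadd, hW]
    have hb : ((norLayer F M S o).b₁ j : EReal) = 1 := F.round_one
    rw [hb, hu]
    split_ifs with h
    · simp [F.round_zero, F.round_one]
    · simp [F.round_zero, F.round_bot]
  have hd : (F.mulVec (norLayer F M S o).W₂ (F.relu (F.vadd (F.mulVec (norLayer F M S o).W₁
      (registerVec F x)) (norLayer F M S o).b₁)) i : EReal) =
      (if coordEquiv.symm i = .inl o then u else 0 : ℝ) := by
    have key (a : Fin 1 → F.Val) : F.mulVec (norLayer F M S o).W₂ a i =
        F.round (((if coordEquiv.symm i = .inl o then F.round 1 else F.round 0 : F.Val) :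
          EReal) * a 0) :=
      F.dot_eq_single (0 : Fin 1) fun j hj => absurd (Subsingleton.elim _ _) hj
    erw [key, hr]
    split_ifs
    · rw [F.round_one, one_mul, F.round_coe hu']
    · rw [F.round_zero, zero_mul, F.round_zero, EReal.coe_zero]
  have hb : ((norLayer F M S o).b₂ i : EReal) = 0 := F.round_zero
  rw [TransformerLayer.feedforward, FloatFormat.vadd, hd, hb, add_zero]
  have : (if coordEquiv.symm i = Sum.inl o then u else 0 : ℝ) = Sum.elim
      (fun r => if r = o then u else 0) (fun _ => 0) (coordEquiv.symm i) := by
    rcases coordEquiv.symm i with r | q <;> simp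
  rw [this, F.round_coe]
  rcases coordEquiv.symm i with r | q
  · simp only [Sum.elim_inl]
    split_ifs
    exacts [hu', F.zero_mem]
  · exact F.zero_mem

/-- The residual connection can only add to a register, so the target must be empty beforehand
(`ho`). -/
theorem norLayer_applySeq (hM : GoodPadding F R M) (A : AttentionKind) {S : Finset R} {o : R}
    {X : ℕ → Fin (width R M) → F.Val} {n : ℕ} {x : R → ℝ} (hX : X n = registerVec F x)
    (hx : ∀ r, x r ∈ F.vals) (ho : x o = 0) (hS : ∀ r ∈ S, 0 ≤ x r) :
    (norLayer F M S o).applySeq A X n =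
      registerVec F (Function.update x o (if ∀ r ∈ S, x r = 0 then 1 else 0)) := by
  have hz := update_mem hx o (ite_mem_vals (F := F) (∀ r ∈ S, x r = 0))
  rw [TransformerLayer.applySeq, hX]
  refine pointwise_registerVec hM rfl rfl rfl rfl hx hz ?_ ?_
  · refine vadd_registerVec (z := 0) hx hx (fun i => ?_) (by simp)
    have : ∀ m, (F.mulVec (norLayer F M S o).WV (X m) i : EReal) = 0 := fun m => by
      have h : F.mulVec (norLayer F M S o).WV (X m) i = F.round 0 :=
        F.dot_eq_zero fun j => Or.inl F.round_zero
      rw [h, F.round_zero]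
    simp only [TransformerLayer.attentionSeq, this, mul_zero, F.round_zero,
      Finset.sum_const_zero]
    rcases coordEquiv.symm i with r | q <;> simp
  · refine vadd_registerVec hx hz (norLayer_feedforward hx hS) fun r => ?_
    by_cases hr : r = o
    · subst hr; simp [ho]
    · simp [hr]

variable (F M) in
/-- A layer that stores in register `o` the attention to register `v`, where positions with
register `p` get score `∞`, positions with register `h` get score `-∞`, and all others score `0`.
Register `one` holds the constant `1`. -/
def attentionLayer (one p h v o : R) : TransformerLayer F (width R M) where
  WQ := fun i j => if coordEquiv.symm i = .inl one ∧ coordEquiv.symm j = .inl one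
    then F.round 1 else F.round 0
  WK := fun i j => if coordEquiv.symm i = .inl one then
      (if coordEquiv.symm j = .inl p then F.round ⊤
      else if coordEquiv.symm j = .inl h then F.round ⊥ else F.round 0)
    else F.round 0
  WV := fun i j => if coordEquiv.symm i = .inl o ∧ coordEquiv.symm j = .inl v
    then F.round 1 else F.round 0
  gain₁ := fun _ => F.round 1
  bias₁ := fun _ => F.round 0
  hiddenSize := 0
  W₁ := fun _ _ => F.round 0
  b₁ := fun _ => F.round 0
  W₂ := fun _ _ => F.round 0
  b₂ := fun _ => F.round 0
  gain₂ := fun _ => F.round 1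
  bias₂ := fun _ => F.round 0

variable (F) in
/-- Scores `∞` where `P` holds, `-∞` where `H` holds, and `0` elsewhere. -/
def infScore (P H : ℕ → Prop) (m : ℕ) : F.Val :=
  F.round (if P m then ⊤ else if H m then ⊥ else 0)

variable (F) in
/-- Attention at position `n` to a property `V`, with scores given by `P` and `H`. -/
def attentionTo (A : AttentionKind) (P H V : ℕ → Prop) (n : ℕ) : F.Val :=
  F.round (∑ m ∈ Finset.range n,
    (F.round ((attentionWeightSeq (infScore F P H) n m A : EReal) * if V m then 1 else 0) : EReal))

/-- The query is the unit vector of register `one`, so the score reads one key coordinate. There `P`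
and `H` contribute `∞` and `-∞`; they must exclude each other because `-∞` would win. -/
theorem attentionLayer_scoreVec {one p h v o : R} {x y : R → ℝ} (hx : ∀ r, x r ∈ F.vals)
    (hy : ∀ r, y r ∈ F.vals) (h1 : x one = 1) {P H : Prop} (hp : y p = if P then 1 else 0)
    (hh : y h = if H then 1 else 0) (hPH : ¬ (P ∧ H)) :
    (attentionLayer F M one p h v o).scoreVec (registerVec F x) (registerVec F y) =
      F.round (if P then ⊤ else if H then ⊥ else 0) := by
  have hcoord : ∀ (z : R → ℝ), (∀ r, z r ∈ F.vals) → ∀ r (i : Fin (width R M)),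
      coordEquiv.symm i = .inl r → (registerVec F z i : EReal) = z r := by
    intro z hz r i hi
    rw [coe_registerVec hz, hi]
    rfl
  have hQ : ∀ i, (F.mulVec (attentionLayer F M one p h v o).WQ (registerVec F x) i : EReal) =
      if coordEquiv.symm i = .inl one then 1 else 0 := by
    intro i
    unfold FloatFormat.mulVec
    rw [F.dot_eq_single (coordEquiv (.inl one))]
    · simp only [attentionLayer, Equiv.symm_apply_apply, and_true]
      rw [hcoord x hx one _ (Equiv.symm_apply_apply _ _), h1]
      split_ifs <;> simp [F.round_one, F.round_zero]
    · intro j hj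
      left
      have hj' : coordEquiv.symm j ≠ .inl one := fun h => hj (by rw [← h]; simp)
      simp [attentionLayer, hj', F.round_zero]
  have hK : F.mulVec (attentionLayer F M one p h v o).WK (registerVec F y)
      (coordEquiv (.inl one)) = F.round (if P then ⊤ else if H then ⊥ else 0) := by
    unfold FloatFormat.mulVec
    by_cases hP : P
    · have hH : ¬ H := fun h => hPH ⟨hP, h⟩
      rw [F.dot_eq_single (coordEquiv (.inl p))]
      · rw [hcoord y hy p _ (Equiv.symm_apply_apply _ _), hp]
        simp [attentionLayer, hP, F.round_top]
      · intro j hj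
        have hj' : coordEquiv.symm j ≠ .inl p := fun h => hj (by rw [← h]; simp)
        by_cases hjh : coordEquiv.symm j = .inl h
        · right
          rw [hcoord y hy h _ hjh, hh]
          simp [hH]
        · left
          simp [attentionLayer, hj', hjh, F.round_zero]
    · by_cases hH : H
      · have hne : h ≠ p := by
          rintro rfl
          rw [hp] at hh
          simp [hP, hH] at hh
        rw [F.dot_eq_single (coordEquiv (.inl h))]
        · rw [hcoord y hy h _ (Equiv.symm_apply_apply _ _), hh]
          simp [attentionLayer, hP, hH, hne, F.round_bot]
        · intro j hj
          have hj' : coordEquiv.symm j ≠ .inl h := fun h => hj (by rw [← h]; simp)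
          by_cases hjp : coordEquiv.symm j = .inl p
          · right
            rw [hcoord y hy p _ hjp, hp]
            simp [hP]
          · left
            simp [attentionLayer, hj', hjp, F.round_zero]
      · rw [F.dot_eq_zero]
        · simp [hP, hH]
        · intro j
          by_cases hjp : coordEquiv.symm j = .inl p
          · right
            rw [hcoord y hy p _ hjp, hp]
            simp [hP]
          by_cases hjh : coordEquiv.symm j = .inl h
          · right
            rw [hcoord y hy h _ hjh, hh]
            simp [hH]
          · left
            simp [attentionLayer, hjp, hjh, F.round_zero]
  -- The scores `0` and `±∞` are unchanged by division by a positive real, so the scaling by `√D` is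
  -- harmless.
  have hD : 0 < Real.sqrt (width R M : ℝ) := by
    have : 0 < width R M := Fintype.card_pos_iff.2 ⟨.inl one⟩
    positivity
  rw [TransformerLayer.scoreVec, F.dot_eq_single (coordEquiv (.inl one)), hQ, hK]
  · simp only [Equiv.symm_apply_apply, if_true, one_mul, F.round_val]
    split_ifs
    · rw [F.round_top, EReal.top_div_of_pos_ne_top (by exact_mod_cast hD) (EReal.coe_ne_top _)]
    · rw [F.round_bot, EReal.bot_div_of_pos_ne_top (by exact_mod_cast hD) (EReal.coe_ne_top _)]
    · rw [F.round_zero, EReal.zero_div]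
  · intro j hj
    left
    have hj' : coordEquiv.symm j ≠ .inl one := fun h => hj (by rw [← h]; simp)
    simp [hQ, hj']

theorem attentionLayer_applySeq (hM : GoodPadding F R M) (A : AttentionKind) {one p h v o : R}
    {x : ℕ → R → ℝ} {n : ℕ} (hx : ∀ m r, x m r ∈ F.vals) (h1 : x n one = 1) (ho : x n o = 0)
    {P H V : ℕ → Prop} (hp : ∀ m, x m p = if P m then 1 else 0)
    (hh : ∀ m, x m h = if H m then 1 else 0) (hv : ∀ m, x m v = if V m then 1 else 0)
    (hPH : ∀ m, ¬ (P m ∧ H m)) {y : ℝ} (hy : y ∈ F.vals)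
    (hy' : (attentionTo F A P H V n : EReal) = y) :
    (attentionLayer F M one p h v o).applySeq A (fun m => registerVec F (x m)) n =
      registerVec F (Function.update (x n) o y) := by
  have hz := update_mem (hx n) o hy
  refine pointwise_registerVec hM rfl rfl rfl rfl hz hz ?_ ?_
  · refine vadd_registerVec (z := fun r => if r = o then y else 0) (hx n) hz (fun i => ?_)
      fun r => ?_
    · have hs : ∀ m, (attentionLayer F M one p h v o).scoreVec (registerVec F (x n))
          (registerVec F (x m)) = infScore F P H m := fun m =>
        attentionLayer_scoreVec (hx n) (hx m) h1 (hp m) (hh m) (hPH m)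
      have hV : ∀ m, (F.mulVec (attentionLayer F M one p h v o).WV (registerVec F (x m)) i :
          EReal) = if coordEquiv.symm i = .inl o then (if V m then 1 else 0) else 0 := by
        intro m
        unfold FloatFormat.mulVec
        rw [F.dot_eq_single (coordEquiv (.inl v))]
        · rw [coe_registerVec (hx m), Equiv.symm_apply_apply]
          simp only [attentionLayer, Equiv.symm_apply_apply, and_true, coordVal, Sum.elim_inl, hv]
          split_ifs <;> simp [F.round_one, F.round_zero]
        · intro j hj
          left
          have hj' : coordEquiv.symm j ≠ .inl v := fun h => hj (by rw [← h]; simp)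
          simp [attentionLayer, hj', F.round_zero]
      simp only [TransformerLayer.attentionSeq, hs, hV]
      by_cases hi : coordEquiv.symm i = .inl o
      · simp only [hi, if_true, Sum.elim_inl, ← hy']
        rfl
      · simp only [hi, if_false, mul_zero, F.round_zero, Finset.sum_const_zero]
        rcases hc : coordEquiv.symm i with r | q
        · have : r ≠ o := fun h => hi (by rw [hc, h])
          simp [this]
        · simp
    · by_cases hr : r = o
      · subst hr; simp [ho]
      · simp [hr]
  · refine vadd_registerVec (z := 0) hz hz (fun i => ?_) (by simp)
    have : (attentionLayer F M one p h v o).feedforward (registerVec F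
        (Function.update (x n) o y)) i = F.round 0 := by
      have h (u : Fin 0 → F.Val) :
          F.mulVec (attentionLayer F M one p h v o).W₂ u i = F.round 0 :=
        F.dot_eq_zero fun j => Fin.elim0 j
      rw [TransformerLayer.feedforward, FloatFormat.vadd]
      erw [h]
      simp [attentionLayer, F.round_zero]
    rw [this, F.round_zero]
    rcases coordEquiv.symm i with r | q <;> simp

end Layers

end

noncomputable section

/-! ### Attention with infinite scores -/

section InfScore

open Classical

variable {F : FloatFormat} {P H V : ℕ → Prop} {n : ℕ}

theorem sum_range_ite (p : ℕ → Prop) (n : ℕ) (c : EReal) :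
    ∑ m ∈ Finset.range n, (if p m then c else 0) = PTL.countBefore p n • c := by
  rw [← Finset.sum_filter, Finset.sum_const]
  rfl

theorem FloatFormat.expo_eq_of_coe_eq {a : F.Val} {b : EReal} (h : (a : EReal) = b) :
    F.expo a = F.round ((EReal.exp b : ENNReal) : EReal) := by
  rw [expo, h]

theorem coe_infScore (m : ℕ) :
    (infScore F P H m : EReal) = if P m then ⊤ else if H m then ⊥ else 0 := by
  unfold infScore
  split_ifs
  exacts [F.round_top, F.round_bot, F.round_zero]

theorem coe_expo_infScore (m : ℕ) :
    (F.expo (infScore F P H m) : EReal) = if P m then ⊤ else if H m then 0 else 1 := by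
  rw [FloatFormat.expo_eq_of_coe_eq (coe_infScore m)]
  split_ifs <;> simp [F.round_top, F.round_zero, F.round_one]

theorem attentionTo_eq_zero (A : AttentionKind) (h : ∀ m < n, ¬ V m) :
    attentionTo F A P H V n = F.round 0 := by
  unfold attentionTo
  rw [Finset.sum_eq_zero]
  intro m hm
  simp [h m (Finset.mem_range.1 hm), F.round_zero]

/-- A score `∞` takes the weight away from every position without `P`: hard attention selects maxima
only, and in soft attention the normalizer `exp ∞ = ∞` makes every weight `0`. Positions with `P`
carry value `0` by `hPV`. -/
theorem attentionTo_eq_zero_of_past (A : AttentionKind) (hPV : ∀ m < n, P m → ¬ V m)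
    (h : ∃ m < n, P m) : attentionTo F A P H V n = F.round 0 := by
  obtain ⟨j, hj, hPj⟩ := h
  have hmax : ∀ m, IsMaxScoreSeq (infScore F P H) n m → P m := by
    intro m hm
    by_contra hPm
    have := hm j hj
    rw [coe_infScore, coe_infScore, if_pos hPj, if_neg hPm] at this
    split_ifs at this <;> simp at this
  unfold attentionTo
  rw [Finset.sum_eq_zero]
  intro m hm
  have hm' := Finset.mem_range.1 hm
  by_cases hV : V m
  · have hnP : ¬ P m := fun h => hPV m hm' h hV
    have hnmax : ¬ IsMaxScoreSeq (infScore F P H) n m := fun h => hnP (hmax m h)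
    have hw : (attentionWeightSeq (infScore F P H) n m A : EReal) = 0 := by
      cases A with
      | soft =>
        have htop : ∑ i ∈ Finset.range n, (F.expo (infScore F P H i) : EReal) = ⊤ := by
          refine top_le_iff.1 (le_trans ?_ (Finset.single_le_sum
            (f := fun i => (F.expo (infScore F P H i) : EReal))
            (fun i _ => F.expo_nonneg _) (Finset.mem_range.2 hj)))
          rw [coe_expo_infScore, if_pos hPj]
        simp only [attentionWeightSeq, htop, F.round_top, EReal.div_top, F.round_zero]
      | averageHard => simp [attentionWeightSeq, hnmax, F.round_zero]
      | uniqueHard => simp [attentionWeightSeq, hnmax, F.round_zero]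
    simp [hw, F.round_zero]
  · simp [hV, F.round_zero]

variable (F) in
/-- The weight of each of `k` positions that share the attention equally. -/
def equalWeight (k : ℕ) : F.Val := F.round (1 / F.round (k : EReal))

variable (F) in
/-- The total weight of `k ≥ 1` positions that share the attention. -/
def totalWeight : AttentionKind → ℕ → F.Val
  | .soft, k => F.round (k • (equalWeight F k : EReal))
  | .averageHard, k => F.round (k • (equalWeight F k : EReal))
  | .uniqueHard, _ => F.round 1

theorem attentionTo_eq_of_equal {A : AttentionKind}
    (hw : ∀ m < n, V m → (attentionWeightSeq (infScore F P H) n m A : EReal) =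
      equalWeight F (PTL.countBefore V n)) :
    attentionTo F A P H V n =
      F.round (PTL.countBefore V n • (equalWeight F (PTL.countBefore V n) : EReal)) := by
  unfold attentionTo
  rw [← sum_range_ite]
  congr 1
  refine Finset.sum_congr rfl fun m hm => ?_
  split_ifs with hV
  · rw [hw m (Finset.mem_range.1 hm) hV, mul_one, F.round_val]
  · rw [mul_zero, F.round_zero]

/-- Without scores `∞`, the `V`-positions have score `0` and all others `-∞`, so the former share
the attention. At least one `V`-position is needed, since otherwise the maximum would not be `0`. -/
theorem attentionTo_eq_totalWeight (A : AttentionKind) (hP : ∀ m < n, ¬ P m)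
    (hV : ∀ m < n, V m ↔ ¬ H m) (h : ∃ m < n, V m) :
    attentionTo F A P H V n = totalWeight F A (PTL.countBefore V n) := by
  have hmax : ∀ m < n, IsMaxScoreSeq (infScore F P H) n m ↔ V m := by
    obtain ⟨j, hj, hVj⟩ := h
    intro m hm
    simp only [IsMaxScoreSeq, coe_infScore, hP m hm, if_false]
    constructor
    · intro hmax
      have := hmax j hj
      simp only [hP j hj, (hV j hj).1 hVj, if_false] at this
      rw [hV m hm]
      intro hH
      simp [hH] at this
    · intro hVm i hi
      simp only [hP i hi, (hV m hm).1 hVm, if_false]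
      split_ifs <;> simp
  cases A with
  | soft =>
    refine attentionTo_eq_of_equal fun m hm hVm => ?_
    have h₁ : ∀ i < n, (F.expo (infScore F P H i) : EReal) = if V i then 1 else 0 := by
      intro i hi
      rw [coe_expo_infScore, if_neg (hP i hi)]
      by_cases hH : H i <;> simp [hV i hi, hH]
    simp only [attentionWeightSeq]
    rw [Finset.sum_congr rfl fun i hi => h₁ i (Finset.mem_range.1 hi), sum_range_ite, nsmul_one,
      h₁ m hm, if_pos hVm]
    rfl
  | averageHard =>
    refine attentionTo_eq_of_equal fun m hm hVm => ?_
    simp only [attentionWeightSeq]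
    rw [Finset.sum_congr rfl fun i hi => if_congr (hmax i (Finset.mem_range.1 hi)) rfl rfl,
      sum_range_ite, nsmul_one, if_pos ((hmax m hm).2 hVm)]
    rfl
  | uniqueHard =>
    obtain ⟨j, hj⟩ := ((Finset.range n).filter V).exists_max_image id
      (by obtain ⟨m, hm, hVm⟩ := h; exact ⟨m, by simp [hm, hVm]⟩)
    simp only [Finset.mem_filter, Finset.mem_range, id, and_imp] at hj
    obtain ⟨⟨hj, hVj⟩, hlast⟩ := hj
    have hw : ∀ m < n, (attentionWeightSeq (infScore F P H) n m .uniqueHard : EReal) =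
        if m = j then 1 else 0 := by
      intro m hm
      simp only [attentionWeightSeq]
      have : (IsMaxScoreSeq (infScore F P H) n m ∧ ∀ i < n,
          IsMaxScoreSeq (infScore F P H) n i → i ≤ m) ↔ m = j := by
        constructor
        · rintro ⟨h₁, h₂⟩
          exact le_antisymm (hlast m hm ((hmax m hm).1 h₁)) (h₂ j hj ((hmax j hj).2 hVj))
        · rintro rfl
          exact ⟨(hmax m hm).2 hVj, fun i hi hmi => hlast i hi ((hmax i hi).1 hmi)⟩
      rw [if_congr this rfl rfl]
      split_ifs
      exacts [F.round_one, F.round_zero]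
    unfold attentionTo totalWeight
    congr 1
    rw [Finset.sum_eq_single_of_mem j (Finset.mem_range.2 hj)]
    · simp [hw j hj, hVj, F.round_one]
    · intro m hm hmj
      simp [hw m (Finset.mem_range.1 hm), hmj, F.round_zero]

/-- Unique hard attention with equal scores attends to the previous position. -/
theorem attentionTo_previous :
    (attentionTo F .uniqueHard (fun _ => False) (fun _ => False) V n : EReal) =
      if ∃ m, n = m + 1 ∧ V m then 1 else 0 := by
  cases n with
  | zero => simp [attentionTo, F.round_zero]
  | succ n =>
    have hmax : ∀ m, IsMaxScoreSeq (infScore F (fun _ => False) (fun _ => False)) (n + 1) m :=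
      fun m i _ => by simp [coe_infScore]
    have hw : ∀ m < n + 1, (attentionWeightSeq (infScore F (fun _ => False) (fun _ => False))
        (n + 1) m .uniqueHard : EReal) = if m = n then 1 else 0 := by
      intro m hm
      simp only [attentionWeightSeq, hmax, true_and, true_imp_iff]
      have : (∀ i < n + 1, i ≤ m) ↔ m = n :=
        ⟨fun h => le_antisymm (by omega) (h n (by omega)), by rintro rfl; omega⟩
      rw [if_congr this rfl rfl]
      split_ifs
      exacts [F.round_one, F.round_zero]
    unfold attentionTo
    rw [Finset.sum_eq_single_of_mem n (by simp)]
    · rw [hw n (by simp), F.round_val]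
      by_cases h : V n <;> simp [h, F.round_one, F.round_zero]
    · intro m hm hmn
      rw [hw m (Finset.mem_range.1 hm)]
      simp [hmn, F.round_zero]

theorem totalWeight_one (A : AttentionKind) : (totalWeight F A 1 : EReal) = 1 := by
  have h1 : (equalWeight F 1 : EReal) = 1 := by
    have h : (1 : EReal) / 1 = 1 := by rw [← EReal.coe_one, ← EReal.coe_div, div_one]
    rw [equalWeight, Nat.cast_one, F.round_one, h, F.round_one]
  cases A <;> simp [totalWeight, h1, F.round_one]

theorem one_le_round_natCast {k : ℕ} (hk : 1 ≤ k) : (1 : EReal) ≤ F.round (k : EReal) := by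
  have := F.round_mono (a := 1) (b := (k : EReal)) (by exact_mod_cast hk)
  rwa [F.round_one] at this

/-- Registers hold finite values only, so attention must not overflow. If `k` itself overflows as a
normalizer, the weights vanish; otherwise each weight is at most `1` and the total at most `k <
F.bound`. -/
theorem exists_totalWeight_eq (A : AttentionKind) {k : ℕ} (hk : 1 ≤ k) :
    ∃ r ∈ F.vals, 0 ≤ r ∧ (totalWeight F A k : EReal) = r := by
  have key : ∃ r ∈ F.vals, 0 ≤ r ∧ (F.round (k • (equalWeight F k : EReal)) : EReal) = r := by
    rcases le_or_gt F.bound k with hb | hb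
    · refine ⟨0, F.zero_mem, le_rfl, ?_⟩
      rw [equalWeight, F.coe_round_of_le (z := (k : EReal)) (by exact_mod_cast hb), EReal.div_top,
        F.round_zero,
        nsmul_zero, F.round_zero, EReal.coe_zero]
    · obtain ⟨r, hr, _, hrk⟩ := F.coe_round_nonneg_le (Nat.cast_nonneg k) hb
      have h1 := one_le_round_natCast (F := F) hk
      rw [EReal.coe_natCast] at hrk
      rw [hrk] at h1
      have h1 : 1 ≤ r := by exact_mod_cast h1
      have hle : 1 / r ≤ 1 := by
        rw [div_le_one (by linarith)]
        exact h1
      obtain ⟨s, hs, hs0, hsr⟩ := F.coe_round_nonneg_le (z := 1 / r) (by positivity)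
        (hle.trans_lt (F.lt_bound 1 F.one_mem))
      have hs1 : s ≤ 1 := by
        have := F.round_mono (EReal.coe_le_coe_iff.2 hle)
        rw [hsr, EReal.coe_one, F.round_one] at this
        exact_mod_cast this
      have hw : (equalWeight F k : EReal) = s := by
        rw [equalWeight, hrk, ← hsr, EReal.coe_div, EReal.coe_one]
      rw [hw, ← EReal.coe_nsmul, nsmul_eq_mul]
      exact F.coe_round_nonneg_le (by positivity)
        ((mul_le_of_le_one_right (Nat.cast_nonneg k) hs1).trans_lt hb)
  cases A with
  | soft => exact key
  | averageHard => exact key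
  | uniqueHard => exact ⟨1, F.one_mem, zero_le_one, F.round_one⟩

theorem equalWeight_nonneg (k : ℕ) : (0 : EReal) ≤ equalWeight F k :=
  F.round_nonneg (EReal.div_nonneg zero_le_one (F.round_nonneg (by exact_mod_cast k.zero_le)))

theorem equalWeight_antitone {k m : ℕ} (hk : 1 ≤ k) (hkm : k ≤ m) :
    (equalWeight F m : EReal) ≤ equalWeight F k := by
  have hpos : ∀ {k : ℕ}, 1 ≤ k → (0 : EReal) < F.round (k : EReal) := fun hk =>
    zero_lt_one.trans_le (one_le_round_natCast hk)
  refine F.round_mono ?_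
  rw [EReal.div_eq_inv_mul, EReal.div_eq_inv_mul, mul_one, mul_one]
  exact EReal.inv_strictAntiOn.antitoneOn (hpos hk) (hpos (hk.trans hkm))
    (F.round_mono (by exact_mod_cast hkm))

/-- Rounding may make the total vanish for many positions, but not for fewer once it survives for
more: individual weights decrease with the number of sharers, and the rounded total is at least one
representable weight. -/
theorem totalWeight_ne_zero (A : AttentionKind) {k m : ℕ} (hk : 1 ≤ k) (hkm : k ≤ m)
    (hm : (totalWeight F A m : EReal) ≠ 0) : (totalWeight F A k : EReal) ≠ 0 := by
  have key (h : (F.round (m • (equalWeight F m : EReal)) : EReal) ≠ 0) :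
      (F.round (k • (equalWeight F k : EReal)) : EReal) ≠ 0 := by
    have hmpos : (0 : EReal) < equalWeight F m := by
      refine (equalWeight_nonneg m).lt_of_ne fun h0 => h ?_
      rw [← h0, nsmul_zero, F.round_zero]
    have hkpos := hmpos.trans_le (equalWeight_antitone hk hkm)
    have hle : (equalWeight F k : EReal) ≤ F.round (k • (equalWeight F k : EReal)) := by
      have := F.round_mono (nsmul_le_nsmul_left hkpos.le hk)
      rwa [one_nsmul, F.round_val] at this
    exact (hkpos.trans_le hle).ne'
  cases A with
  | soft => exact key hm
  | averageHard => exact key hm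
  | uniqueHard => exact hm

end InfScore

end

noncomputable section

/-! ### Transformers that simulate formulas -/

section Compile

open Classical

variable {β : Type*}

/-- The truth value of a property of pointed strings. -/
def indicator (P : List β → ℕ → Prop) : List β → ℕ → ℝ := fun w n => if P w n then 1 else 0

theorem indicator_congr {P P' : List β → ℕ → Prop} (h : ∀ w n, P w n ↔ P' w n) :
    indicator P = indicator P' := by
  have : P = P' := funext fun w => funext fun n => propext (h w n)
  rw [this]

theorem indicator_mem {F : FloatFormat} (P : List β → ℕ → Prop) (w : List β) (n : ℕ) :
    indicator P w n ∈ F.vals := ite_mem_vals _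

theorem indicator_nonneg (P : List β → ℕ → Prop) (w : List β) (n : ℕ) : 0 ≤ indicator P w n := by
  unfold indicator
  split_ifs <;> simp

theorem indicator_eq_zero {P : List β → ℕ → Prop} {w : List β} {n : ℕ} :
    indicator P w n = 0 ↔ ¬ P w n := by
  simp [indicator]

/-- Whether the registers in `S` are all zero. -/
def nor (S : Finset (List β → ℕ → ℝ)) : List β → ℕ → ℝ := indicator fun w n => ∀ f ∈ S, f w n = 0

variable (β) in
/-- The functions that tell the letter at the current position. -/
def letterFuns [Finite β] : Finset (List β → ℕ → ℝ) :=
  (Set.finite_range fun a : β => indicator fun w n => w[n]? = some a).toFinset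

/-- The contents of registers `G`, at position `n` of `w`, when those in `H` have been computed. -/
def registerState (G H : Finset (List β → ℕ → ℝ)) (w : List β) (n : ℕ) : G → ℝ :=
  fun f => if f.1 ∈ H then f.1 w n else 0

theorem registerState_mem {F : FloatFormat} {G : Finset (List β → ℕ → ℝ)} (hG : ∀ f ∈ G, ∀ w n, f w n ∈ F.vals)
    (H : Finset (List β → ℕ → ℝ)) (w : List β) (n : ℕ) (f : G) :
    registerState G H w n f ∈ F.vals := by
  unfold registerState
  split_ifs
  exacts [hG f.1 f.2 w n, F.zero_mem]

theorem exists_attention_value {F : FloatFormat} (A : AttentionKind) {P H V : List β → ℕ → Prop}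
    (hV : ∀ w n, V w n ↔ ¬ P w n ∧ ¬ H w n) :
    ∃ f : List β → ℕ → ℝ, (∀ w n, f w n ∈ F.vals) ∧ (∀ w n, 0 ≤ f w n) ∧
      (∀ w n, (attentionTo F A (P w) (H w) (V w) n : EReal) = f w n) ∧
      (∀ w n, (∃ m < n, P w m) → f w n = 0) ∧ (∀ w n, (∀ m < n, ¬ V w m) → f w n = 0) ∧
      ∀ w n, (∀ m < n, ¬ P w m) → (∃ m < n, V w m) →
        (f w n : EReal) = totalWeight F A (PTL.countBefore (V w) n) := by
  have hzero₁ : ∀ w n, (∃ m < n, P w m) →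
      (attentionTo F A (P w) (H w) (V w) n : EReal) = 0 := fun w n h => by
    rw [attentionTo_eq_zero_of_past A (fun m _ hP hVm => ((hV w m).1 hVm).1 hP) h, F.round_zero]
  have hzero₂ : ∀ w n, (∀ m < n, ¬ V w m) →
      (attentionTo F A (P w) (H w) (V w) n : EReal) = 0 := fun w n h => by
    rw [attentionTo_eq_zero A h, F.round_zero]
  have htotal : ∀ w n, (∀ m < n, ¬ P w m) → (∃ m < n, V w m) →
      attentionTo F A (P w) (H w) (V w) n = totalWeight F A (PTL.countBefore (V w) n) :=
    fun w n h₁ h₂ => attentionTo_eq_totalWeight A h₁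
      (fun m hm => by rw [hV]; simp [h₁ m hm]) h₂
  have h : ∀ w n, ∃ r ∈ F.vals, 0 ≤ r ∧
      (attentionTo F A (P w) (H w) (V w) n : EReal) = r := by
    intro w n
    by_cases h₁ : ∃ m < n, P w m
    · exact ⟨0, F.zero_mem, le_rfl, by rw [hzero₁ w n h₁, EReal.coe_zero]⟩
    by_cases h₂ : ∃ m < n, V w m
    · rw [htotal w n (by simpa using h₁) h₂]
      refine exists_totalWeight_eq A ?_
      obtain ⟨m, hm, hVm⟩ := h₂
      exact Finset.card_pos.2 ⟨m, by simp [hm, hVm]⟩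
    · exact ⟨0, F.zero_mem, le_rfl, by rw [hzero₂ w n (by simpa using h₂), EReal.coe_zero]⟩
  choose f hf hf0 hfa using h
  refine ⟨f, hf, hf0, hfa, fun w n h => ?_, fun w n h => ?_, fun w n h₁ h₂ => ?_⟩
  · have := hfa w n
    rw [hzero₁ w n h] at this
    exact_mod_cast this.symm
  · have := hfa w n
    rw [hzero₂ w n h] at this
    exact_mod_cast this.symm
  · rw [← hfa, htotal w n h₁ h₂]

variable (F : FloatFormat) (A : AttentionKind) [Finite β]

/-- The functions in `H` can be computed by a transformer whose registers include `H`. -/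
def Realizable (H : Finset (List β → ℕ → ℝ)) : Prop :=
  letterFuns β ⊆ H ∧ (∀ f ∈ H, ∀ w n, f w n ∈ F.vals) ∧
  ∀ G, H ⊆ G → (∀ f ∈ G, ∀ w n, f w n ∈ F.vals) → ∀ M, GoodPadding F G M →
    ∃ L : List (TransformerLayer F (width G M)), ∀ w,
      runSeq A L (fun i => registerVec F (registerState G (letterFuns β) w i)) =
        fun n => registerVec F (registerState G H w n)

/-- Every realizable set can be enlarged to one that contains `f`. -/
def Attainable (f : List β → ℕ → ℝ) : Prop :=
  ∀ H, Realizable F A H → ∃ H', H ⊆ H' ∧ Realizable F A H' ∧ f ∈ H'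

variable {F A}

theorem realizable_letterFuns : Realizable F A (letterFuns β) := by
  refine ⟨subset_rfl, fun f hf w n => ?_, fun G _ _ M _ => ⟨[], fun w => rfl⟩⟩
  obtain ⟨a, rfl⟩ := by simpa [letterFuns] using hf
  exact indicator_mem _ w n

/-- Registers are indexed by the functions they are to hold. Working for every larger register set
`G` lets layers be appended before the final width is known. -/
theorem Realizable.insert {H : Finset (List β → ℕ → ℝ)} (hH : Realizable F A H)
    {f : List β → ℕ → ℝ} (hf : ∀ w n, f w n ∈ F.vals) (hfH : f ∉ H)
    (h : ∀ G, H ⊆ G → (∀ f ∈ G, ∀ w n, f w n ∈ F.vals) → ∀ M, GoodPadding F G M → ∀ o : G, o.1 = f →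
      ∃ ℓ : TransformerLayer F (width G M), ∀ w n,
        ℓ.applySeq A (fun i => registerVec F (registerState G H w i)) n =
          registerVec F (Function.update (registerState G H w n) o (f w n))) :
    Realizable F A (insert f H) := by
  refine ⟨hH.1.trans (Finset.subset_insert _ _), ?_, fun G hHG hG M hM => ?_⟩
  · intro g hg
    rcases Finset.mem_insert.1 hg with rfl | hg
    exacts [hf, hH.2.1 g hg]
  · obtain ⟨hfG, hHG⟩ := Finset.insert_subset_iff.1 hHG
    obtain ⟨L, hL⟩ := hH.2.2 G hHG hG M hM
    obtain ⟨ℓ, hℓ⟩ := h G hHG hG M hM ⟨f, hfG⟩ rfl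
    refine ⟨L ++ [ℓ], fun w => ?_⟩
    have happ : runSeq A (L ++ [ℓ]) (fun i => registerVec F (registerState G (letterFuns β) w i)) =
        ℓ.applySeq A (runSeq A L
          (fun i => registerVec F (registerState G (letterFuns β) w i))) := by
      simp [runSeq]
    rw [happ, hL]
    funext n
    rw [hℓ]
    congr 1
    funext g
    by_cases hg : g = ⟨f, hfG⟩
    · subst hg
      simp [registerState]
    · have hg' : g.1 ≠ f := fun h => hg (Subtype.ext h)
      simp [registerState, Function.update_of_ne hg, hg']

theorem exists_realizable_superset {S : Finset (List β → ℕ → ℝ)} (hS : ∀ f ∈ S, Attainable F A f)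
    {H : Finset (List β → ℕ → ℝ)} (hH : Realizable F A H) :
    ∃ H', H ⊆ H' ∧ Realizable F A H' ∧ S ⊆ H' := by
  induction S using Finset.induction_on with
  | empty => exact ⟨H, subset_rfl, hH, Finset.empty_subset _⟩
  | insert f S _ ih =>
    obtain ⟨H₁, h₁, hH₁, hS₁⟩ := ih fun g hg => hS g (Finset.mem_insert_of_mem hg)
    obtain ⟨H₂, h₂, hH₂, hf⟩ := hS f (Finset.mem_insert_self _ _) H₁ hH₁
    exact ⟨H₂, h₁.trans h₂, hH₂, Finset.insert_subset hf (hS₁.trans h₂)⟩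

theorem attainable_letter (a : β) : Attainable F A (indicator fun w n => w[n]? = some a) :=
  fun H hH => ⟨H, subset_rfl, hH, hH.1 (by simp [letterFuns])⟩

theorem attainable_nor {S : Finset (List β → ℕ → ℝ)} (hS : ∀ f ∈ S, Attainable F A f)
    (hpos : ∀ f ∈ S, ∀ w n, 0 ≤ f w n) : Attainable F A (nor S) := by
  intro H hH
  obtain ⟨H₁, h₁, hH₁, hSH⟩ := exists_realizable_superset hS hH
  -- If the function is already stored, its register is not empty and must not be added to again.
  by_cases hf : nor S ∈ H₁
  · exact ⟨H₁, h₁, hH₁, hf⟩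
  refine ⟨insert (nor S) H₁, h₁.trans (Finset.subset_insert _ _),
    hH₁.insert (indicator_mem _) hf fun G hHG hG M hM o ho =>
      ⟨norLayer F M (Finset.univ.filter fun f : G => f.1 ∈ S) o, fun w n => ?_⟩,
    Finset.mem_insert_self _ _⟩
  rw [norLayer_applySeq hM A rfl (registerState_mem hG H₁ w n)]
  · congr! 2
    have hiff : (∀ r ∈ Finset.univ.filter (fun f : G => f.1 ∈ S), registerState G H₁ w n r = 0) ↔
        ∀ f ∈ S, f w n = 0 := by
      refine ⟨fun h f hfS => ?_, fun h f hfS => ?_⟩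
      · have := h ⟨f, hHG (hSH hfS)⟩ (by simp [hfS])
        simpa [registerState, hSH hfS] using this
      · have hfS := (Finset.mem_filter.1 hfS).2
        simp [registerState, h _ hfS]
    unfold nor indicator
    split_ifs with h₁ h₂ h₂
    exacts [rfl, absurd (hiff.1 h₁) h₂, absurd (hiff.2 h₂) h₁, rfl]
  · simp [registerState, ho, hf]
  · intro f hfS
    have hfS := (Finset.mem_filter.1 hfS).2
    unfold registerState
    split_ifs
    exacts [hpos _ hfS w n, le_rfl]

theorem attainable_nor_two {f g : List β → ℕ → ℝ} (hf : Attainable F A f) (hg : Attainable F A g)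
    (hf0 : ∀ w n, 0 ≤ f w n) (hg0 : ∀ w n, 0 ≤ g w n) :
    Attainable F A (indicator fun w n => f w n = 0 ∧ g w n = 0) := by
  have := attainable_nor (F := F) (A := A) (S := {f, g}) (by simp [hf, hg]) (by
    simp only [Finset.mem_insert, Finset.mem_singleton]
    rintro _ (rfl | rfl)
    exacts [hf0, hg0])
  simpa [nor] using this

theorem attainable_true : Attainable F A (indicator fun (_ : List β) _ => True) := by
  have := attainable_nor (F := F) (A := A) (β := β) (S := ∅) (by simp) (by simp)
  simpa [nor] using this

theorem attainable_nor_indicator {P Q : List β → ℕ → Prop} (hP : Attainable F A (indicator P))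
    (hQ : Attainable F A (indicator Q)) :
    Attainable F A (indicator fun w n => ¬ P w n ∧ ¬ Q w n) := by
  simpa only [indicator_eq_zero] using
    attainable_nor_two hP hQ (indicator_nonneg P) (indicator_nonneg Q)

theorem attainable_not {P : List β → ℕ → Prop} (hP : Attainable F A (indicator P)) :
    Attainable F A (indicator fun w n => ¬ P w n) := by
  simpa only [and_self] using attainable_nor_indicator hP hP

theorem attainable_and {P Q : List β → ℕ → Prop} (hP : Attainable F A (indicator P))
    (hQ : Attainable F A (indicator Q)) : Attainable F A (indicator fun w n => P w n ∧ Q w n) := by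
  simpa only [not_not] using attainable_nor_indicator (attainable_not hP) (attainable_not hQ)

theorem attainable_attention {P H V : List β → ℕ → Prop} (hP : Attainable F A (indicator P))
    (hH : Attainable F A (indicator H)) (hV : Attainable F A (indicator V))
    (hPH : ∀ w n, ¬ (P w n ∧ H w n)) {f : List β → ℕ → ℝ} (hf : ∀ w n, f w n ∈ F.vals)
    (hf' : ∀ w n, (attentionTo F A (P w) (H w) (V w) n : EReal) = f w n) : Attainable F A f := by
  intro K hK
  obtain ⟨K₁, h₁, hK₁, hsub⟩ := exists_realizable_superset
    (S := {indicator fun _ _ => True, indicator P, indicator H, indicator V})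
    (by simp [hP, hH, hV, attainable_true]) hK
  simp only [Finset.insert_subset_iff, Finset.singleton_subset_iff] at hsub
  obtain ⟨hT', hP', hH', hV'⟩ := hsub
  by_cases hfK : f ∈ K₁
  · exact ⟨K₁, h₁, hK₁, hfK⟩
  refine ⟨insert f K₁, h₁.trans (Finset.subset_insert _ _),
    hK₁.insert hf hfK fun G hKG hG M hM o ho =>
      ⟨attentionLayer F M ⟨_, hKG hT'⟩ ⟨_, hKG hP'⟩ ⟨_, hKG hH'⟩ ⟨_, hKG hV'⟩ o,
        fun w n => ?_⟩,
    Finset.mem_insert_self _ _⟩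
  refine (attentionLayer_applySeq hM A (fun m => registerState_mem hG K₁ w m)
    (P := P w) (H := H w) (V := V w) ?_ ?_ ?_ ?_ ?_ (hPH w) (hf w n) (hf' w n)).trans (by congr!)
  · simp only [registerState, if_pos hT']
    simp [indicator]
  · simp [registerState, ho, hfK]
  · intro m
    simp only [registerState, if_pos hP']
    rfl
  · intro m
    simp only [registerState, if_pos hH']
    rfl
  · intro m
    simp only [registerState, if_pos hV']
    rfl

/-! ### The first position and the past operator -/

theorem countBefore_eq_one {p : ℕ → Prop} {n j : ℕ} (h : ∀ m < n, p m ↔ m = j) (hj : j < n) :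
    PTL.countBefore p n = 1 := by
  unfold PTL.countBefore
  rw [Finset.card_eq_one]
  refine ⟨j, ?_⟩
  ext m
  simp only [Finset.mem_filter, Finset.mem_range, Finset.mem_singleton]
  constructor
  · rintro ⟨hm, hp⟩
    exact (h m hm).1 hp
  · rintro rfl
    exact ⟨hj, (h m hj).2 rfl⟩

/-- Uniform attention to the constant `1` gives `f`, which is `0` at position `0` and `1` at
position `1`, but may round to `0` again far out. A second attention `g`, shared only among
positions where `f` is nonzero, stays nonzero from position `2` on; so `f` and `g` vanish together
only at the start. -/
theorem attainable_first : Attainable F A (indicator fun (_ : List β) n => n = 0) := by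
  obtain ⟨f, hf, hf0, hfa, -, hfz, hft⟩ := exists_attention_value (β := β) (F := F) A
    (P := fun _ _ => False) (H := fun _ _ => False) (V := fun _ _ => True) (by simp)
  have htrue := attainable_true (F := F) (A := A) (β := β)
  have hfalse : Attainable F A (indicator fun (_ : List β) _ => False) := by
    simpa using attainable_not htrue
  have hfatt : Attainable F A f := attainable_attention hfalse hfalse htrue (by simp) hf hfa
  have hf₀ : ∀ w, f w 0 = 0 := fun w => hfz w 0 (by simp)
  have hft' : ∀ w n, 1 ≤ n → (f w n : EReal) = totalWeight F A n := by
    intro w n hn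
    rw [hft w n (by simp) ⟨0, hn, trivial⟩]
    congr
    simp [PTL.countBefore]
  have hf₁ : ∀ w, f w 1 ≠ 0 := by
    intro w h
    have := hft' w 1 le_rfl
    rw [h, totalWeight_one] at this
    norm_num at this
  have hZ : Attainable F A (indicator fun w n => f w n = 0) := by
    simpa using attainable_nor_two hfatt hfatt hf0 hf0
  obtain ⟨g, hg, hg0, hga, -, hgz, hgt⟩ := exists_attention_value (β := β) (F := F) A
    (P := fun _ _ => False) (H := fun w n => f w n = 0) (V := fun w n => ¬ f w n = 0) (by simp)
  have hgatt : Attainable F A g :=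
    attainable_attention hfalse hZ (attainable_not hZ) (by simp) hg hga
  have := attainable_nor_two hfatt hgatt hf0 hg0
  rwa [indicator_congr] at this
  intro w n
  constructor
  · rintro ⟨h₁, h₂⟩
    by_contra hn
    have hn2 : 2 ≤ n := by
      rcases n with _ | _ | n
      · exact absurd rfl hn
      · exact absurd h₁ (hf₁ w)
      · omega
    have hex : ∃ m < n, ¬ f w m = 0 := ⟨1, by omega, hf₁ w⟩
    have hgk := hgt w n (by simp) hex
    obtain ⟨m, hm, hmax⟩ := ((Finset.range n).filter fun m => ¬ f w m = 0).exists_max_image id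
      (by obtain ⟨m, hm, h⟩ := hex; exact ⟨m, by simp [hm, h]⟩)
    simp only [Finset.mem_filter, Finset.mem_range, id, and_imp] at hm hmax
    have hm1 : 1 ≤ m := by
      by_contra h
      exact hm.2 (by rw [show m = 0 by omega]; exact hf₀ w)
    -- With `m` the last position before `n` where `f` is nonzero, all such positions lie in `1, …,
    -- m`. Since the total weight for `m` sharers is `f w m ≠ 0`, it is also nonzero for the smaller
    -- count.
    have hk : PTL.countBefore (fun m => ¬ f w m = 0) n ≤ m := by
      have hsub : (Finset.range n).filter (fun m => ¬ f w m = 0) ⊆ Finset.Icc 1 m := by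
        intro i hi
        simp only [Finset.mem_filter, Finset.mem_range] at hi
        refine Finset.mem_Icc.2 ⟨?_, hmax i hi.1 hi.2⟩
        by_contra h
        exact hi.2 (by rw [show i = 0 by omega]; exact hf₀ w)
      have := Finset.card_le_card hsub
      simp only [Nat.card_Icc, Nat.add_sub_cancel] at this
      exact (le_of_eq (by unfold PTL.countBefore; congr!)).trans this
    have hk1 : 1 ≤ PTL.countBefore (fun m => ¬ f w m = 0) n := by
      obtain ⟨m, hm, h⟩ := hex
      exact Finset.card_pos.2 ⟨m, by simp [hm, h]⟩
    refine totalWeight_ne_zero A hk1 hk ?_ (by rw [← hgk, h₂, EReal.coe_zero])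
    rw [← hft' w m hm1]
    exact_mod_cast hm.2
  · rintro rfl
    exact ⟨hf₀ w, hgz w 0 (by simp)⟩

/-- The first position, when it lacks `P`, acts as a sink of score `0`, the only position with `V`.
Its single weight `1` survives rounding and signals that `P` has not occurred; position `0` has
nothing to attend to and is excluded separately. -/
theorem attainable_past {P : List β → ℕ → Prop} (hP : Attainable F A (indicator P)) :
    Attainable F A (indicator fun w n => ∃ m < n, P w m) := by
  have hfirst := attainable_first (F := F) (A := A) (β := β)
  have hH := attainable_nor_indicator hP hfirst
  have hV := attainable_and (attainable_not hP) (attainable_not hH)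
  obtain ⟨f, hf, hf0, hfa, hfP, hfz, hft⟩ := exists_attention_value (β := β) (F := F) A
    (P := P) (H := fun w n => ¬ P w n ∧ ¬ n = 0) (fun w n => Iff.rfl)
  have hfatt := attainable_attention hP hH hV (fun w n h => h.2.1 h.1) hf hfa
  have := attainable_nor_two hfatt hfirst hf0 (indicator_nonneg _)
  rwa [indicator_congr] at this
  intro w n
  rw [indicator_eq_zero]
  constructor
  · rintro ⟨h, hn⟩
    by_contra hne
    push Not at hne
    have h0 : 0 < n := Nat.pos_of_ne_zero hn
    have hiff : ∀ m < n, (¬ P w m ∧ ¬ (¬ P w m ∧ ¬ m = 0)) ↔ m = 0 := by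
      intro m hm
      have := hne m hm
      tauto
    have := hft w n hne ⟨0, h0, (hiff 0 h0).2 rfl⟩
    rw [countBefore_eq_one hiff h0, h, totalWeight_one] at this
    norm_num at this
  · rintro ⟨m, hm, hPm⟩
    exact ⟨hfP w n ⟨m, hm, hPm⟩, by omega⟩

theorem attainable_sat (ψ : PTL β) : Attainable F A (indicator fun w n => ψ.Sat w n) := by
  induction ψ with
  | atom a => exact attainable_letter a
  | and φ ψ h₁ h₂ => exact attainable_and h₁ h₂
  | not φ h => exact attainable_not h
  | past φ h => exact attainable_past h

end Compile

/-! ### From attainable functions to transformers -/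

namespace Transformer

variable {F : FloatFormat} {A : AttentionKind} {α : Type*} [Finite α]

theorem exists_final_eq {f : List (Option α) → ℕ → ℝ} (hf : Attainable F A f) :
    ∃ (T : Transformer F α) (d : Fin T.dim), ∀ (w : List α) (n : Fin (withEOS w).length),
      (T.final A w n d : EReal) = f (withEOS w) n := by
  obtain ⟨G, -, hG, hfG⟩ := hf _ realizable_letterFuns
  obtain ⟨M, hM⟩ := exists_goodPadding F G
  obtain ⟨L, hL⟩ := hG.2.2 G subset_rfl hG.2.1 M hM
  -- A letter is embedded by evaluating the letter registers on the one-letter string; beyond the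
  -- end the empty string gives zeros.
  let E : Option (Option α) → Fin (width G M) → F.Val := fun a =>
    registerVec F (registerState G (letterFuns (Option α)) a.toList 0)
  refine ⟨⟨width G M, fun a => E (some a), L, fun _ => F.round 0, F.round 0⟩,
    coordEquiv (.inl ⟨f, hfG⟩), fun w n => ?_⟩
  have hE : ∀ i, E (withEOS w)[i]? =
      registerVec F (registerState G (letterFuns (Option α)) (withEOS w) i) := by
    intro i
    simp only [E]
    congr 1
    funext g
    unfold registerState
    split_ifs with hg
    · obtain ⟨a, ha⟩ := by simpa [letterFuns] using hg
      rw [← ha]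
      have hiff : (withEOS w)[i]?.toList[0]? = some a ↔ (withEOS w)[i]? = some a := by
        cases (withEOS w)[i]? <;> simp
      unfold indicator
      split_ifs with h₁ h₂ h₂
      exacts [rfl, absurd (hiff.1 h₁) h₂, absurd (hiff.2 h₂) h₁, rfl]
    · rfl
  rw [Transformer.final_eq _ A w E (fun _ => rfl) n]
  simp only [hE, hL]
  rw [coe_registerVec (registerState_mem hG.2.1 G _ _), Equiv.symm_apply_apply]
  simp [coordVal, registerState, hfG]

theorem exists_simulatesPTL (ψ : PTL (Option α)) :
    ∃ T : Transformer F α, T.SimulatesPTL A ψ := by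
  obtain ⟨T, d, h⟩ := exists_final_eq (attainable_sat (F := F) (A := A) ψ)
  exact ⟨T, d, fun w n => ⟨fun hs => by simp [h, indicator, hs], fun hs => by
    simp [h, indicator, hs]⟩⟩

theorem mem_recognizable {P : List (Option α) → ℕ → Prop} (hP : Attainable F A (indicator P)) :
    ({w | P (withEOS w) w.length} : Language α) ∈ recognizable F A α := by
  obtain ⟨T, d, h⟩ := exists_final_eq hP
  refine ⟨{ T with
    headWeight := fun i => if i = d then F.round 1 else F.round 0
    headBias := F.round 0 }, Set.ext fun w => ?_⟩
  have hd : F.dot (fun i => if i = d then F.round 1 else F.round 0) (T.final A w (eosPos w)) =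
      T.final A w (eosPos w) d := by
    rw [F.dot_eq_single d fun j hj => Or.inl (by simp [hj, F.round_zero])]
    simp [F.round_one, F.round_val]
  have hout : (0 : EReal) < F.round ((F.dot (fun i => if i = d then F.round 1 else F.round 0)
      (T.final A w (eosPos w)) : EReal) + (F.round 0 : EReal)) ↔ P (withEOS w) w.length := by
    rw [hd, F.round_zero, add_zero, F.round_val, h]
    simp only [indicator, eosPos]
    split_ifs with hp <;> simp [hp]
  exact hout

theorem definable_subset_recognizable : PTL.definable α ⊆ recognizable F A α := by
  rintro _ ⟨ψ, rfl⟩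
  have h := mem_recognizable (attainable_sat (F := F) (A := A) ψ.extend)
  have : ψ.language = {w | ψ.extend.Sat (withEOS w) w.length} :=
    Set.ext fun w => (ψ.sat_extend w le_rfl).symm
  rwa [this]

end Transformer

/-! ### Unique hard attention is strictly stronger -/

/-- The strings that end with the letter `a`. -/
def lastLetter {α : Type*} (a : α) : Language α := {w | w.getLast? = some a}

/-- With all scores equal, the rightmost choice is the previous position, which at the end symbol
holds the last letter of the word. -/
theorem lastLetter_mem_recognizable {α : Type*} [Finite α] (F : FloatFormat) (a : α) :
    lastLetter a ∈ Transformer.recognizable F .uniqueHard α := by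
  classical
  have hfalse : Attainable F .uniqueHard (indicator fun (_ : List (Option α)) _ => False) := by
    simpa using attainable_not (attainable_true (F := F) (A := .uniqueHard) (β := Option α))
  have h : Attainable F .uniqueHard
      (indicator fun (w : List (Option α)) n => ∃ m, n = m + 1 ∧ w[m]? = some (some a)) :=
    attainable_attention hfalse hfalse (attainable_letter (some a)) (by simp)
      (fun w n => ite_mem_vals _) fun w n => by
        rw [attentionTo_previous]
        simp only [indicator]
        split_ifs <;> simp
  have hL : lastLetter a = {w | ∃ m, w.length = m + 1 ∧ (withEOS w)[m]? = some (some a)} := by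
    refine Set.ext fun w => ?_
    change w.getLast? = some a ↔ ∃ m, w.length = m + 1 ∧ (withEOS w)[m]? = some (some a)
    rw [List.getLast?_eq_getElem?]
    constructor
    · intro hw
      obtain ⟨hlt, -⟩ := List.getElem?_eq_some_iff.1 hw
      refine ⟨w.length - 1, by omega, ?_⟩
      rw [getElem?_withEOS, if_pos hlt, hw]
      rfl
    · rintro ⟨m, hm, h⟩
      rw [getElem?_withEOS, if_pos (by omega)] at h
      rw [hm]
      simpa using h
  rw [hL]
  exact Transformer.mem_recognizable h

/-! ### Alternating strings -/

/-- The prefix of length `N` of the string that alternates between `a` and `b`. -/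
def alternating {α : Type*} (a b : α) (N : ℕ) : List α :=
  (List.range N).map fun i => if Even i then a else b

/-- Letter tests fail just beyond the end, and a past formula once true stays true, because longer
prefixes agree at all earlier positions. -/
theorem PTL.eventually_sat_alternating {α : Type*} (a b : α) (ψ : PTL α) :
    ∃ K, ∀ N ≥ K, ψ.Sat (alternating a b N) N ↔ ψ.Sat (alternating a b K) K := by
  induction ψ with
  | atom c => exact ⟨0, fun N _ => by simp [Sat, alternating]⟩
  | and φ ψ h₁ h₂ =>
    obtain ⟨K₁, h₁⟩ := h₁
    obtain ⟨K₂, h₂⟩ := h₂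
    refine ⟨max K₁ K₂, fun N hN => ?_⟩
    simp only [Sat]
    rw [h₁ N (le_of_max_le_left hN), h₂ N (le_of_max_le_right hN), h₁ _ (le_max_left _ _),
      h₂ _ (le_max_right _ _)]
  | not φ h =>
    obtain ⟨K, h⟩ := h
    exact ⟨K, fun N hN => not_congr (h N hN)⟩
  | past φ =>
    have hpre : ∀ {m N K : ℕ}, m < N → m < K →
        (φ.Sat (alternating a b N) m ↔ φ.Sat (alternating a b K) m) := fun hN hK =>
      φ.sat_congr fun i hi => by
        simp [alternating, hi.trans_lt hN, hi.trans_lt hK]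
    by_cases h : ∃ K, (past φ).Sat (alternating a b K) K
    · obtain ⟨K, hK⟩ := h
      refine ⟨K, fun N hN => iff_of_true ?_ hK⟩
      obtain ⟨m, hm, hs⟩ := hK
      exact ⟨m, hm.trans_le hN, (hpre hm (hm.trans_le hN)).1 hs⟩
    · push Not at h
      exact ⟨0, fun N _ => iff_of_false (h N) (h 0)⟩

theorem lastLetter_notMem_definable {α : Type*} {a b : α} (hab : a ≠ b) :
    lastLetter a ∉ PTL.definable α := by
  rintro ⟨ψ, hψ⟩
  obtain ⟨K, hK⟩ := ψ.eventually_sat_alternating a b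
  have h : ∀ N, ψ.Sat (alternating a b N) N ↔ (alternating a b N).getLast? = some a := by
    intro N
    have h : ψ.Sat (alternating a b N) (alternating a b N).length ↔
        (alternating a b N).getLast? = some a := Set.ext_iff.1 hψ (alternating a b N)
    have hlen : (alternating a b N).length = N := by simp [alternating]
    rwa [hlen] at h
  have hlast : ∀ N, (alternating a b (N + 1)).getLast? = some (if Even N then a else b) := by
    intro N
    simp [alternating, List.range_succ]
  -- Two consecutive lengths beyond `K`: the first prefix ends with `a`, the second with `b`.
  have h₁ := (hK (2 * K + 1) (by omega)).trans (hK (2 * K + 1 + 1) (by omega)).symm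
  rw [h, h, hlast, hlast] at h₁
  simp [hab.symm] at h₁

/-! ### The main theorem -/

theorem Transformer.recognizable_eq_definable {α : Type*} [Finite α] [Nonempty α] (F : FloatFormat)
    {A : AttentionKind} (hA : A ≠ .uniqueHard) : recognizable F A α = PTL.definable α :=
  (recognizable_subset_definable hA).antisymm definable_subset_recognizable

theorem Transformer.definable_ssubset_uniqueHard {α : Type*} [Finite α] [Nontrivial α]
    (F : FloatFormat) : PTL.definable α ⊂ recognizable F .uniqueHard α := by
  obtain ⟨a, b, hab⟩ := exists_pair_ne α
  exact (Set.ssubset_iff_of_subset definable_subset_recognizable).2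
    ⟨_, lastLetter_mem_recognizable F a, lastLetter_notMem_definable hab⟩

theorem mainTheorem7 {α : Type*} [Finite α] [Nonempty α] (F : FloatFormat) :
    (∀ T : Transformer F α, T.SimulatedByPFO .averageHard) ∧
    (∀ ψ : PTL (Option α), ∃ T : Transformer F α, T.SimulatesPTL .averageHard ψ) ∧
    Transformer.recognizable F .averageHard α = Transformer.recognizable F .soft α ∧
    Transformer.recognizable F .averageHard α = PTL.definable α ∧
    Transformer.recognizable F .soft α = PTL.definable α ∧
    PTL.definable α = PFO.definable α ∧
    Transformer.recognizable F .averageHard α ⊆ Transformer.recognizable F .uniqueHard α ∧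
    Transformer.recognizable F .soft α ⊆ Transformer.recognizable F .uniqueHard α ∧
    (Nontrivial α →
      Transformer.recognizable F .averageHard α ⊂ Transformer.recognizable F .uniqueHard α ∧
      Transformer.recognizable F .soft α ⊂ Transformer.recognizable F .uniqueHard α) := by
  have h₁ := Transformer.recognizable_eq_definable (α := α) F (A := .averageHard) (by simp)
  have h₂ := Transformer.recognizable_eq_definable (α := α) F (A := .soft) (by simp)
  rw [h₁, h₂]
  exact ⟨fun T => T.simulatedByPFO (by simp), Transformer.exists_simulatesPTL, rfl, rfl, rfl,
    PTL.definable_eq_PFO_definable, Transformer.definable_subset_recognizable,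
    Transformer.definable_subset_recognizable, fun _ =>
      ⟨Transformer.definable_ssubset_uniqueHard F, Transformer.definable_ssubset_uniqueHard F⟩⟩

end
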